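/- Let $\mathbb K$ be a field. A central $\ell$-arrangement $\mathcal A$ is a finite set of linear hyperplanes $H=\ker\alpha_H$ in a $\mathbb K$-vector space $V$ of dimension $\ell$. Let $S=\mathbb K[x_1,\dots,x_\ell]$ be the symmetric algebra of $V^*$ and $Q(\mathcal A)=\prod_{H\in\mathcal A}\alpha_H$. The arrangement $\mathcal A$ is free with exponents $(e_1,\dots,e_\ell)$ if the $S$-module $D(\mathcal A)=\{\theta\in\mathrm{Der}_{\mathbb K}(S)\mid \theta(Q(\mathcal A))\in Q(\mathcal A)S\}$ has a basis of homogeneous derivations $\theta_1,\dots,\theta_\ell$, where the coefficients of $\theta_i$ are homogeneous of degree $e_i$. A flat is an intersection of members of $\mathcal A$ (the empty intersection being $V$), and the restriction of $\mathcal A$ to a flat $X$ is the arrangement $\mathcal A^X=\{H\cap X\mid H\in\mathcal A,\ X\not\subseteq H\}$ in $X$. Let $\mathcal A$ be free with exponents $e_1\le e_2\le\dots\le e_\ell$. A witness for the accuracy of $\mathcal A$ is a tuple $(X_1,\dots,X_\ell)$ of flats such that, for every $1\le d\le\ell$, $\dim X_d=d$ and $\mathcal A^{X_d}$ is free with exponents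 $(e_1,\dots,e_d)$. The arrangement $\mathcal A$ is accurate if there is such a witness, and flag-accurate if there is one with $X_1\subseteq X_2\subseteq\dots\subseteq X_\ell$. For $1\le k\le \ell-1$ it is $k$-coaccurate if there is a witness such that $k$ is the minimal element of $\{1,\dots,\ell-1\}$ for which $X_1\subseteq X_2\subseteq\dots\subseteq X_{\ell-k}$. The graphic arrangement of a finite simple graph $G$ with vertex set $V_G$ is the arrangement $\mathcal A_G=\{\ker(x_u-x_v)\mid \{u,v\}\in E_G\}$ in $\mathbb K^{V_G}$. Theorem. Let $k\ge1$, and let $G$ be the graph on $7k+4$ vertices obtained from the complete graph on $\{1,2,3,4\}$ by adding, for each of its six edges $\{i,j\}$, $k$ new vertices adjacent to exactly $i$ and $j$, and then $k$ further vertices $v_1,\dots,v_k$, each adjacent to exactly $1$, $2$ and $3$. Then, over every field $\mathbb K$, $\mathcal A_G$ is $(k+1)$-coaccurate, but it is not $j$-coaccurate for any $1\le j\le k$; in particular, it is not $k$-coaccurate. Moreover, $\mathcal A_G$ is accurate but not flag-accurate, so accurate graphic arrangements need not be flag-accurate. -/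

import Mathlib

/-- A central hyperplane arrangement in the `K`-vector space `V`: a finite set of linear
hyperplanes, i.e. of kernels of nonzero linear forms. -/
structure CentralArrangement (K V : Type*) [Field K] [AddCommGroup V] [Module K V] where
  hyperplanes : Set (Submodule K V)
  finite : hyperplanes.Finite
  isHyperplane : ∀ H ∈ hyperplanes, ∃ α : Module.Dual K V, α ≠ 0 ∧ LinearMap.ker α = H

/-- With respect to a basis `b` of `V`, the symmetric algebra of the dual space is the polynomial
ring in the coordinates dual to `b`; this is the linear form `α` as an element of that ring. -/
noncomputable def linearFormPoly {K V ι : Type*} [Field K] [AddCommGroup V] [Module K V]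
    [Fintype ι] (b : Module.Basis ι K V) (α : Module.Dual K V) : MvPolynomial ι K :=
  ∑ i, MvPolynomial.C (α (b i)) * MvPolynomial.X i

namespace CentralArrangement

variable {K V : Type*} [Field K] [AddCommGroup V] [Module K V]

open Classical in
/-- A linear form with kernel `H`, for a hyperplane `H` (and `0` for other subspaces). -/
noncomputable def definingForm (H : Submodule K V) : Module.Dual K V :=
  if h : ∃ α : Module.Dual K V, α ≠ 0 ∧ LinearMap.ker α = H then h.choose else 0

theorem ker_definingForm (A : CentralArrangement K V) {H : Submodule K V}
    (hH : H ∈ A.hyperplanes) : LinearMap.ker (definingForm H) = H := by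
  have h := A.isHyperplane H hH
  rw [definingForm, dif_pos h]
  exact h.choose_spec.2

/-- The defining polynomial `Q(A)`, the product of the defining linear forms of the hyperplanes. -/
noncomputable def definingPoly (A : CentralArrangement K V) {ι : Type*} [Fintype ι]
    (b : Module.Basis ι K V) : MvPolynomial ι K :=
  ∏ H ∈ A.finite.toFinset, linearFormPoly b (definingForm H)

/-- The module `D(A)` of `A`-derivations: the derivations `θ` of the polynomial ring `S` with
`θ(Q(A)) ∈ Q(A) S`. -/
noncomputable def derivationModule (A : CentralArrangement K V) {ι : Type*} [Fintype ι]
    (b : Module.Basis ι K V) :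
    Submodule (MvPolynomial ι K) (Derivation K (MvPolynomial ι K) (MvPolynomial ι K)) where
  carrier := {θ | A.definingPoly b ∣ θ (A.definingPoly b)}
  add_mem' := fun hx hy => by
    simp only [Set.mem_ofPred_eq, Derivation.add_apply] at *
    exact dvd_add hx hy
  zero_mem' := by simp
  smul_mem' := fun c x hx => by
    simp only [Set.mem_ofPred_eq, Derivation.smul_apply, smul_eq_mul] at *
    exact Dvd.dvd.mul_left hx c

/-- `A` is free with exponents `e 0, …, e (n - 1)` (in any order), where `n = dim V`: the module
`D(A)` has a basis of homogeneous derivations whose degrees are the `e i`. A derivation is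
homogeneous of degree `p` if all its coefficients `θ (X j)` are homogeneous polynomials of
degree `p`. The choice of the coordinates (of `b`) is irrelevant. -/
def FreeWithExponents (A : CentralArrangement K V) {n : ℕ} (e : Fin n → ℕ) : Prop :=
  ∃ (b : Module.Basis (Fin n) K V)
    (θ : Module.Basis (Fin n) (MvPolynomial (Fin n) K) (A.derivationModule b)),
    ∀ i j : Fin n,
      ((θ i : Derivation K (MvPolynomial (Fin n) K) (MvPolynomial (Fin n) K))
        (MvPolynomial.X j)).IsHomogeneous (e i)

/-- `X ∈ L(A)`: `X` is an intersection of hyperplanes of `A` (the empty intersection being `V`). -/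
def IsFlat (A : CentralArrangement K V) (X : Submodule K V) : Prop :=
  ∃ B ⊆ A.hyperplanes, X = sInf B

/-- The restriction `A^X = {H ∩ X | H ∈ A, X ⊄ H}`, an arrangement in the space `X`. -/
def restrict (A : CentralArrangement K V) (X : Submodule K V) : CentralArrangement K X where
  hyperplanes := (fun H => H.comap X.subtype) '' {H | H ∈ A.hyperplanes ∧ ¬ X ≤ H}
  finite := (A.finite.subset fun _ h => h.1).image _
  isHyperplane := by
    rintro _ ⟨H, ⟨hH, hX⟩, rfl⟩
    obtain ⟨α, -, rfl⟩ := A.isHyperplane H hH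
    refine ⟨α ∘ₗ X.subtype, fun h0 => hX fun x hx => ?_, LinearMap.ker_comp _ _⟩
    simpa using LinearMap.congr_fun h0 ⟨x, hx⟩

/-- `(X 1, …, X ℓ)`, with `ℓ = dim V`, is a witness for the accuracy of `A`: the arrangement `A` is
free with exponents `e_1 ≤ … ≤ e_ℓ`, and for `1 ≤ d ≤ ℓ` the flat `X d` has dimension `d` and the
restriction of `A` to it is free with exponents `e_1, …, e_d`. (The values of `X` outside
`1, …, ℓ` play no role.) -/
def IsAccuracyWitness (A : CentralArrangement K V) (X : ℕ → Submodule K V) : Prop :=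
  ∃ e : Fin (Module.finrank K V) → ℕ, Monotone e ∧ A.FreeWithExponents e ∧
    ∀ d : ℕ, 1 ≤ d → ∀ hd : d ≤ Module.finrank K V,
      A.IsFlat (X d) ∧ Module.finrank K (X d) = d ∧
        (A.restrict (X d)).FreeWithExponents fun i : Fin d => e (Fin.castLE hd i)

/-- `A` is accurate. -/
def IsAccurate (A : CentralArrangement K V) : Prop :=
  ∃ X : ℕ → Submodule K V, A.IsAccuracyWitness X

/-- `X 1 ⊆ X 2 ⊆ … ⊆ X m`. -/
def IsFlagUpTo (X : ℕ → Submodule K V) (m : ℕ) : Prop :=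
  ∀ c d : ℕ, 1 ≤ c → c ≤ d → d ≤ m → X c ≤ X d

/-- `A` is `k`-coaccurate: there is a witness `(X_1, …, X_ℓ)` for the accuracy of `A` such that
`k` is minimal, among `1, …, ℓ - 1`, subject to `(X_1, …, X_{ℓ-k})` being a flag. -/
def IsCoaccurate (A : CentralArrangement K V) (k : ℕ) : Prop :=
  ∃ X : ℕ → Submodule K V, A.IsAccuracyWitness X ∧
    IsLeast {j : ℕ | 1 ≤ j ∧ j < Module.finrank K V ∧
      IsFlagUpTo X (Module.finrank K V - j)} k

/-- `A` is flag-accurate: the members of a witness for its accuracy can be chosen to form a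
flag. -/
def IsFlagAccurate (A : CentralArrangement K V) : Prop :=
  ∃ X : ℕ → Submodule K V, A.IsAccuracyWitness X ∧ IsFlagUpTo X (Module.finrank K V)

end CentralArrangement

/-- The graphic arrangement of `G` over `K`: the hyperplanes `ker (x_i - x_j)` of the space `K^V`
for the edges `{i, j}` of `G`. -/
def graphicArrangement (K : Type*) [Field K] {V : Type*} [Finite V] (G : SimpleGraph V) :
    CentralArrangement K (V → K) where
  hyperplanes := {H | ∃ i j : V, G.Adj i j ∧
    H = LinearMap.ker
      ((LinearMap.proj i : (V → K) →ₗ[K] K) - (LinearMap.proj j : (V → K) →ₗ[K] K))}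
  finite := by
    refine (Set.finite_range fun p : V × V => LinearMap.ker
      ((LinearMap.proj p.1 : (V → K) →ₗ[K] K) - (LinearMap.proj p.2 : (V → K) →ₗ[K] K))).subset ?_
    rintro H ⟨i, j, -, rfl⟩
    exact ⟨(i, j), rfl⟩
  isHyperplane := by
    classical
    rintro H ⟨i, j, hij, rfl⟩
    refine ⟨_, fun h0 => ?_, rfl⟩
    have h := LinearMap.congr_fun h0 (Pi.single i 1)
    simp [hij.ne'] at h

/-- The edges `{i, j}`, `i < j`, of the complete graph on `Fin n`. -/
abbrev InnerEdge (n : ℕ) : Type := {p : Fin n × Fin n // p.1 < p.2}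

/-- The vertices of `Q_n(M)`: those of the inner complete graph, and for each inner edge `e` the
tips of the `M e` outer triangles attached to `e`. -/
abbrev QVertex (n : ℕ) (M : InnerEdge n → ℕ) : Type := Fin n ⊕ (Σ e : InnerEdge n, Fin (M e))

/-- The graph `Q_n(M)`: a complete graph on `n` vertices with `M e` outer triangles attached to
each edge `e`; the tip of such a triangle is adjacent to exactly the two ends of `e`. -/
def qGraph (n : ℕ) (M : InnerEdge n → ℕ) : SimpleGraph (QVertex n M) where
  Adj x y :=
    match x, y with
    | Sum.inl i, Sum.inl j => i ≠ j
    | Sum.inl i, Sum.inr u => i = u.1.1.1 ∨ i = u.1.1.2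
    | Sum.inr u, Sum.inl i => i = u.1.1.1 ∨ i = u.1.1.2
    | Sum.inr _, Sum.inr _ => False
  symm := ⟨by
    rintro (i | u) (j | w) h
    · exact Ne.symm h
    · exact h
    · exact h
    · exact h⟩
  loopless := ⟨by
    rintro (i | u) h
    · exact h rfl
    · exact h⟩

/-- The graph `Q_4(M)` with all entries of `M` equal to `k`, together with `k` further vertices
`v_1, …, v_k`, each adjacent to exactly the first three inner vertices, so that these span with
`v_i` a complete graph on four vertices. -/
def extendedQFour (k : ℕ) : SimpleGraph (QVertex 4 (fun _ => k) ⊕ Fin k) where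
  Adj x y :=
    match x, y with
    | Sum.inl a, Sum.inl b => (qGraph 4 fun _ => k).Adj a b
    | Sum.inl (Sum.inl i), Sum.inr _ => i ≠ 3
    | Sum.inr _, Sum.inl (Sum.inl i) => i ≠ 3
    | Sum.inl (Sum.inr _), Sum.inr _ => False
    | Sum.inr _, Sum.inl (Sum.inr _) => False
    | Sum.inr _, Sum.inr _ => False
  symm := ⟨by
    rintro ((i | u) | v) ((j | w) | v') h
    all_goals first | exact h | exact SimpleGraph.Adj.symm (G := qGraph 4 fun _ => k) h⟩
  loopless := ⟨by
    rintro (a | v) h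
    · exact (qGraph 4 fun _ => k).loopless.irrefl a h
    · exact h⟩

/-! The graph is a split graph: a complete core with pairwise non-adjacent outer vertices. For such
a graph on a core of size `m`, `D(A)` has an explicit triangular basis of degrees `0, …, m - 1`
together with one degree `|N t|` per outer vertex `t` (`freeWithExponents_split_iff`). Contracting
core vertices, and outer vertices into neighbours, again gives a split graph, so the exponents of
such restrictions are read off by counting. Here the exponents are `0`, `1`, then `6k + 1` twos and
`k + 1` threes.

Existence: up to dimension `6k + 3` only `0`, `1` and twos are wanted. Identifying core vertices `0`
and `1` turns every `v_i` into a vertex of degree 2 and makes only the `k` tips over `{0, 1}`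
pendant. Absorbing these leaves dimension `6k + 3`, and deleting further outer vertices or
contracting the core gives a flag below it. From `6k + 4` on the core stays intact and the `v_i` are
released one by one.

Obstruction: in every witness `X (6k+3)` is not contained in `X (6k+4)`. Identifying two core
vertices forces the `k` tips over that edge to collapse too, since a free pendant tip would give a
third exponent at most 1 (`three_le_card_of_pendant`). This costs `k + 1` dimensions, so the core is
intact in dimension `6k + 4`; it uses up the only exponent 3 there, and every `v_i` is glued to the
core. In dimension `6k + 3` no exponent 3 is allowed, so a core edge and its `k` tips collapse. An
inclusion would glue the `v_i` as well, leaving dimension at most `5k + 3`, which is too small for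
`k ≥ 1`. -/

open MvPolynomial

/-! ### Linear forms as primes of the polynomial ring -/

section LinearForms

variable {K V ι : Type*} [Field K] [AddCommGroup V] [Module K V] [Fintype ι]
  (b : Module.Basis ι K V)

/-- The linear map sending a linear form to the corresponding polynomial. -/
noncomputable def linearFormPolyHom : Module.Dual K V →ₗ[K] MvPolynomial ι K where
  toFun := linearFormPoly b
  map_add' α β := by simp [linearFormPoly, add_mul, Finset.sum_add_distrib]
  map_smul' c α := by simp [linearFormPoly, Finset.mul_sum, smul_eq_C_mul, mul_assoc]

@[simp]
theorem linearFormPolyHom_apply (α : Module.Dual K V) :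
    linearFormPolyHom b α = linearFormPoly b α := rfl

theorem linearFormPoly_coord (i : ι) : linearFormPoly b (b.coord i) = X i := by
  classical
  simp [linearFormPoly, Finsupp.single_apply]

theorem isHomogeneous_linearFormPoly (α : Module.Dual K V) :
    (linearFormPoly b α).IsHomogeneous 1 := by
  refine IsHomogeneous.sum _ _ _ fun i _ => ?_
  simpa using (isHomogeneous_C ι (α (b i))).mul (isHomogeneous_X K i)

theorem linearFormPolyHom_injective : Function.Injective (linearFormPolyHom b) := by
  classical
  refine (injective_iff_map_eq_zero _).2 fun α h => b.ext fun i => ?_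
  have h' := congrArg (coeff (Finsupp.single i 1)) h
  simpa [linearFormPoly, coeff_sum, coeff_C_mul, coeff_X, Finsupp.single_left_inj] using h'

theorem linearFormPoly_eq_zero_iff {α : Module.Dual K V} : linearFormPoly b α = 0 ↔ α = 0 :=
  map_eq_zero_iff (linearFormPolyHom b) (linearFormPolyHom_injective b)

theorem totalDegree_linearFormPoly {α : Module.Dual K V} (hα : α ≠ 0) :
    (linearFormPoly b α).totalDegree = 1 :=
  (isHomogeneous_linearFormPoly b α).totalDegree ((linearFormPoly_eq_zero_iff b).not.2 hα)

/-- In total degree 1 the only possible proper factor is a constant dividing all coefficients, and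
some coefficient is a nonzero scalar; irreducibles of the polynomial ring are prime. -/
theorem prime_linearFormPoly {α : Module.Dual K V} (hα : α ≠ 0) :
    Prime (linearFormPoly b α) := by
  refine (irreducible_of_totalDegree_eq_one (totalDegree_linearFormPoly b hα) fun x hx => ?_).prime
  obtain ⟨i, hi⟩ := MvPolynomial.ne_zero_iff.1 ((linearFormPoly_eq_zero_iff b).not.2 hα)
  refine isUnit_iff_ne_zero.2 fun h => hi ?_
  simpa [h] using hx i

theorem ker_eq_of_linearFormPoly_dvd {α β : Module.Dual K V} (hα : α ≠ 0) (hβ : β ≠ 0)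
    (h : linearFormPoly b α ∣ linearFormPoly b β) : LinearMap.ker α = LinearMap.ker β := by
  obtain ⟨u, hu⟩ := (prime_linearFormPoly b hα).irreducible.associated_of_dvd
    (prime_linearFormPoly b hβ).irreducible h
  obtain ⟨c, hc, hcu⟩ := MvPolynomial.isUnit_iff_eq_C_of_isReduced.1 u.isUnit
  have : β = c • α := linearFormPolyHom_injective b <| by
    rw [map_smul, smul_eq_C_mul, ← hcu, linearFormPolyHom_apply, linearFormPolyHom_apply, ← hu,
      mul_comm]
  rw [this, LinearMap.ker_smul _ _ hc.ne_zero]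

theorem isRelPrime_linearFormPoly {α β : Module.Dual K V} (hα : α ≠ 0) (hβ : β ≠ 0)
    (h : LinearMap.ker α ≠ LinearMap.ker β) :
    IsRelPrime (linearFormPoly b α) (linearFormPoly b β) :=
  ((prime_linearFormPoly b hα).irreducible.isRelPrime_iff_not_dvd).2
    fun hd => h (ker_eq_of_linearFormPoly_dvd b hα hβ hd)

/-- Forms with the same kernel are proportional. This frees the criterion for `D(A)` from the
arbitrary choice in `definingForm`. -/
theorem linearFormPoly_dvd_iff_of_ker_eq {α β : Module.Dual K V} (hα : α ≠ 0)
    (h : LinearMap.ker α = LinearMap.ker β)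
    (θ : Derivation K (MvPolynomial ι K) (MvPolynomial ι K))
    (hd : linearFormPoly b α ∣ θ (linearFormPoly b α)) :
    linearFormPoly b β ∣ θ (linearFormPoly b β) := by
  have hmem : β ∈ Submodule.span K (Set.range fun _ : Unit => α) :=
    mem_span_of_iInf_ker_le_ker (by simpa using h.le)
  rw [Set.range_const, Submodule.mem_span_singleton] at hmem
  obtain ⟨c, rfl⟩ := hmem
  have hc : c ≠ 0 := by
    rintro rfl
    refine hα (LinearMap.ker_eq_top.1 ?_)
    simpa using h
  have e : linearFormPoly b (c • α) = c • linearFormPoly b α := (linearFormPolyHom b).map_smul c α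
  rw [e, Derivation.map_smul, smul_eq_C_mul, smul_eq_C_mul]
  exact mul_dvd_mul_left _ hd

end LinearForms

/-! ### Membership in `D(A)`, one hyperplane at a time -/

namespace CentralArrangement

variable {K V ι : Type*} [Field K] [AddCommGroup V] [Module K V] [Fintype ι]
  (A : CentralArrangement K V) (b : Module.Basis ι K V)

theorem definingForm_ne_zero {H : Submodule K V} (hH : H ∈ A.hyperplanes) :
    (definingForm H : Module.Dual K V) ≠ 0 := by
  have h := A.isHyperplane H hH
  rw [definingForm, dif_pos h]
  exact h.choose_spec.1

/-- By Leibniz on `Q = α_H · R`, `α_H` divides `θ(Q)` iff it divides `R · θ(α_H)`, and it is coprime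
to `R`. Pairwise coprimality then reassembles divisibility by `Q`. -/
theorem mem_derivationModule_iff_definingForm
    {θ : Derivation K (MvPolynomial ι K) (MvPolynomial ι K)} :
    θ ∈ A.derivationModule b ↔ ∀ H ∈ A.hyperplanes,
      linearFormPoly b (definingForm H) ∣ θ (linearFormPoly b (definingForm H)) := by
  classical
  have hrel : ∀ H ∈ A.hyperplanes, ∀ H' ∈ A.hyperplanes, H ≠ H' →
      IsRelPrime (linearFormPoly b (definingForm H)) (linearFormPoly b (definingForm H')) :=
    fun H hH H' hH' hne => isRelPrime_linearFormPoly b (A.definingForm_ne_zero hH)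
      (A.definingForm_ne_zero hH') (by
        rwa [A.ker_definingForm hH, A.ker_definingForm hH'])
  have key : ∀ H ∈ A.hyperplanes, (linearFormPoly b (definingForm H) ∣ θ (A.definingPoly b) ↔
      linearFormPoly b (definingForm H) ∣ θ (linearFormPoly b (definingForm H))) := by
    intro H hH
    have hmem : H ∈ A.finite.toFinset := A.finite.mem_toFinset.2 hH
    rw [definingPoly, ← Finset.mul_prod_erase _ _ hmem, Derivation.leibniz, smul_eq_mul,
      smul_eq_mul, dvd_add_right (dvd_mul_right _ _)]
    refine ⟨fun h => ?_, fun h => h.mul_left _⟩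
    refine IsRelPrime.dvd_of_dvd_mul_left (IsRelPrime.prod_right fun H' hH' => ?_) h
    rw [Finset.mem_erase, A.finite.mem_toFinset] at hH'
    exact hrel H hH H' hH'.2 hH'.1.symm
  constructor
  · intro h H hH
    refine (key H hH).1 (dvd_trans ?_ (show A.definingPoly b ∣ θ (A.definingPoly b) from h))
    exact Finset.dvd_prod_of_mem (fun H => linearFormPoly b (definingForm H))
      (A.finite.mem_toFinset.2 hH)
  · intro h
    show A.definingPoly b ∣ θ (A.definingPoly b)
    refine Finset.prod_dvd_of_isRelPrime (fun H hH H' hH' hne => ?_) fun H hH => ?_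
    · exact hrel H (by simpa using hH) H' (by simpa using hH') hne
    · rw [A.finite.mem_toFinset] at hH
      exact (key H hH).2 (h H hH)

theorem mem_derivationModule_iff {I : Type*} {α : I → Module.Dual K V}
    (hA : A.hyperplanes = Set.range fun i => LinearMap.ker (α i)) (hα : ∀ i, α i ≠ 0)
    {θ : Derivation K (MvPolynomial ι K) (MvPolynomial ι K)} :
    θ ∈ A.derivationModule b ↔ ∀ i, linearFormPoly b (α i) ∣ θ (linearFormPoly b (α i)) := by
  rw [mem_derivationModule_iff_definingForm, hA, Set.forall_mem_range]
  have hH : ∀ i, LinearMap.ker (α i) ∈ A.hyperplanes := fun i => hA ▸ ⟨i, rfl⟩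
  exact forall_congr' fun i =>
    ⟨linearFormPoly_dvd_iff_of_ker_eq b (A.definingForm_ne_zero (hH i))
      (A.ker_definingForm (hH i)) θ,
    linearFormPoly_dvd_iff_of_ker_eq b (hα i) (A.ker_definingForm (hH i)).symm θ⟩

end CentralArrangement

/-! ### Derivations determined by their values on linear forms -/

section DerivationOfLinear

variable {K V ι : Type*} [Field K] [AddCommGroup V] [Module K V] [Fintype ι]
  (b : Module.Basis ι K V)

/-- The derivation with prescribed values on the linear forms. -/
noncomputable def derivationOfLinear (L : Module.Dual K V →ₗ[K] MvPolynomial ι K) :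
    Derivation K (MvPolynomial ι K) (MvPolynomial ι K) :=
  mkDerivation K fun i => L (b.coord i)

@[simp]
theorem derivationOfLinear_linearFormPoly (L : Module.Dual K V →ₗ[K] MvPolynomial ι K)
    (α : Module.Dual K V) : derivationOfLinear b L (linearFormPoly b α) = L α := by
  have h : ∑ i, α (b i) • b.coord i = α := b.ext fun j => by
    classical
    simp
  rw [← congrArg L h, map_sum]
  simp [linearFormPoly, derivationOfLinear, smul_eq_C_mul]

/-- Two derivations agree as soon as they agree on a basis of the linear forms. -/
theorem derivation_ext_of_dual_basis {W : Type*} (y : Module.Basis W K (Module.Dual K V))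
    {θ η : Derivation K (MvPolynomial ι K) (MvPolynomial ι K)}
    (h : ∀ w, θ (linearFormPoly b (y w)) = η (linearFormPoly b (y w))) : θ = η := by
  have : θ.toLinearMap ∘ₗ linearFormPolyHom b = η.toLinearMap ∘ₗ linearFormPolyHom b :=
    y.ext h
  refine derivation_ext fun i => ?_
  simpa [linearFormPoly_coord] using LinearMap.congr_fun this (b.coord i)

/-- A derivation is homogeneous if its values on a basis of the linear forms are. -/
theorem isHomogeneous_apply_X_of_dual_basis {W : Type*} (y : Module.Basis W K (Module.Dual K V))
    {θ : Derivation K (MvPolynomial ι K) (MvPolynomial ι K)} {p : ℕ}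
    (h : ∀ w, (θ (linearFormPoly b (y w))).IsHomogeneous p) (i : ι) :
    (θ (X i)).IsHomogeneous p := by
  have : (⊤ : Submodule K (Module.Dual K V)) ≤
      (homogeneousSubmodule ι K p).comap (θ.toLinearMap ∘ₗ linearFormPolyHom b) := by
    rw [← y.span_eq, Submodule.span_le]
    rintro _ ⟨w, rfl⟩
    exact h w
  rw [← linearFormPoly_coord b]
  exact this Submodule.mem_top

end DerivationOfLinear

/-! ### Uniqueness of the degrees of a homogeneous basis -/

section GradedRank

attribute [local instance] MvPolynomial.gradedAlgebra

variable {K σ : Type*} [Field K]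

theorem homogeneousComponent_mul_of_isHomogeneous (c h : MvPolynomial σ K) {e : ℕ}
    (hh : h.IsHomogeneous e) (f : ℕ) :
    homogeneousComponent f (c * h) =
      if e ≤ f then homogeneousComponent (f - e) c * h else 0 := by
  have := DirectSum.coe_decompose_mul_of_right_mem (homogeneousSubmodule σ K) (a := c) (b := h)
    f hh
  simp only [← decomposition.decompose'_apply]
  exact this

/-- Evaluation of derivations at a fixed element, as a linear map. -/
noncomputable def derivationEval (x : MvPolynomial σ K) :
    Derivation K (MvPolynomial σ K) (MvPolynomial σ K) →ₗ[MvPolynomial σ K] MvPolynomial σ K where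
  toFun θ := θ x
  map_add' _ _ := rfl
  map_smul' _ _ := rfl

@[simp]
theorem derivationEval_apply (x : MvPolynomial σ K)
    (θ : Derivation K (MvPolynomial σ K) (MvPolynomial σ K)) : derivationEval x θ = θ x := rfl

/-- A homogeneous family of degree at most `p` that is linearly independent in a module of
derivations has at most as many members as a homogeneous basis has members of degree at
most `p`. -/
theorem card_le_card_degree_le {ι μ : Type*} [Fintype ι] [Fintype μ]
    {D : Submodule (MvPolynomial σ K) (Derivation K (MvPolynomial σ K) (MvPolynomial σ K))}
    (θ : Module.Basis ι (MvPolynomial σ K) D) {e : ι → ℕ}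
    (hθ : ∀ i j, ((θ i : Derivation K (MvPolynomial σ K) (MvPolynomial σ K))
      (X j)).IsHomogeneous (e i))
    {η : μ → D} (hη : LinearIndependent (MvPolynomial σ K) η) {f : μ → ℕ} {p : ℕ}
    (hf : ∀ m, f m ≤ p)
    (hηf : ∀ m j, ((η m : Derivation K (MvPolynomial σ K) (MvPolynomial σ K))
      (X j)).IsHomogeneous (f m)) :
    Fintype.card μ ≤ (Finset.univ.filter fun i => e i ≤ p).card := by
  classical
  have hspan : Set.range η ≤ Submodule.span (MvPolynomial σ K)
      (((Finset.univ.filter fun i => e i ≤ p).image θ : Finset D) : Set D) := by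
    rintro _ ⟨m, rfl⟩
    -- Taking the component of degree `f m` of the basis expansion discards all basis elements of
    -- larger degree.
    have hsum : η m = ∑ i, (if e i ≤ f m then
        homogeneousComponent (f m - e i) (θ.repr (η m) i) else 0) • θ i := by
      refine Subtype.ext (derivation_ext fun j => ?_)
      have h1 := congrArg ((derivationEval (X j)).comp D.subtype) (θ.sum_repr (η m))
      have h2 := congrArg (homogeneousComponent (f m)) h1
      rw [LinearMap.comp_apply _ _ (η m), Submodule.subtype_apply, derivationEval_apply,
        homogeneousComponent_of_mem (hηf m j), if_pos rfl] at h2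
      refine h2.symm.trans (Eq.trans ?_
        (show ((derivationEval (X j)).comp D.subtype) (∑ i, (if e i ≤ f m then
          homogeneousComponent (f m - e i) (θ.repr (η m) i) else 0) • θ i) = _ from rfl))
      simp only [map_sum, map_smul]
      refine Finset.sum_congr rfl fun i _ => ?_
      simp only [LinearMap.comp_apply, Submodule.subtype_apply, derivationEval_apply, smul_eq_mul]
      rw [homogeneousComponent_mul_of_isHomogeneous _ _ (hθ i j), ite_mul, zero_mul]
    rw [hsum]
    refine Submodule.sum_mem _ fun i _ => ?_
    split_ifs with h
    · exact Submodule.smul_mem _ _ (Submodule.subset_span (Finset.mem_coe.2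
        (Finset.mem_image_of_mem _ (by simpa using h.trans (hf m)))))
    · simp
  -- An independent family inside the span of finitely many elements is no larger than that spanning
  -- set.
  have := linearIndependent_le_span' η hη _ hspan
  rw [Cardinal.mk_fintype, Nat.cast_le] at this
  refine this.trans ?_
  simpa using Finset.card_image_le

theorem card_degree_le_le {ι μ : Type*} [Fintype ι] [Fintype μ]
    {D : Submodule (MvPolynomial σ K) (Derivation K (MvPolynomial σ K) (MvPolynomial σ K))}
    (θ : Module.Basis ι (MvPolynomial σ K) D) {e : ι → ℕ}
    (hθ : ∀ i j, ((θ i : Derivation K (MvPolynomial σ K) (MvPolynomial σ K))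
      (X j)).IsHomogeneous (e i))
    (η : Module.Basis μ (MvPolynomial σ K) D) {f : μ → ℕ}
    (hη : ∀ i j, ((η i : Derivation K (MvPolynomial σ K) (MvPolynomial σ K))
      (X j)).IsHomogeneous (f i)) (p : ℕ) :
    (Finset.univ.filter fun i => f i ≤ p).card ≤ (Finset.univ.filter fun i => e i ≤ p).card := by
  have := card_le_card_degree_le θ hθ (μ := {i // f i ≤ p}) (η := fun i => η i)
    (η.linearIndependent.comp _ Subtype.val_injective) (f := fun i => f i) (p := p)
    (fun i => i.2) (fun i j => hη i j)
  rwa [Fintype.card_subtype] at this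

/-- The degrees of a homogeneous basis of a module of derivations are unique. -/
theorem card_degree_eq {ι μ : Type*} [Fintype ι] [Fintype μ]
    {D : Submodule (MvPolynomial σ K) (Derivation K (MvPolynomial σ K) (MvPolynomial σ K))}
    (θ : Module.Basis ι (MvPolynomial σ K) D) {e : ι → ℕ}
    (hθ : ∀ i j, ((θ i : Derivation K (MvPolynomial σ K) (MvPolynomial σ K))
      (X j)).IsHomogeneous (e i))
    (η : Module.Basis μ (MvPolynomial σ K) D) {f : μ → ℕ}
    (hη : ∀ i j, ((η i : Derivation K (MvPolynomial σ K) (MvPolynomial σ K))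
      (X j)).IsHomogeneous (f i)) (p : ℕ) :
    (Finset.univ.filter fun i => e i = p).card = (Finset.univ.filter fun i => f i = p).card := by
  classical
  have hle : ∀ q, (Finset.univ.filter fun i => e i ≤ q).card =
      (Finset.univ.filter fun i => f i ≤ q).card := fun q =>
    (card_degree_le_le η hη θ hθ q).antisymm (card_degree_le_le θ hθ η hη q)
  cases p with
  | zero => simpa using hle 0
  | succ q =>
    have h1 : (Finset.univ.filter fun i => e i ≤ q + 1) =
        (Finset.univ.filter fun i => e i ≤ q) ∪ Finset.univ.filter fun i => e i = q + 1 := by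
      ext; simp; lia
    have h2 : (Finset.univ.filter fun i => f i ≤ q + 1) =
        (Finset.univ.filter fun i => f i ≤ q) ∪ Finset.univ.filter fun i => f i = q + 1 := by
      ext; simp; lia
    have h := hle (q + 1)
    rw [h1, h2, Finset.card_union_of_disjoint, Finset.card_union_of_disjoint, hle q] at h
    · lia
    all_goals
      refine Finset.disjoint_left.2 fun i => ?_
      simp
      lia

end GradedRank

/-! ### Split graphs and their explicit basis of derivations -/

/-- The graph consisting of a complete graph on `Fin m` and further pairwise non-adjacent vertices
`t : T`, the neighbours of `t` being the members of `N t`. -/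
def splitGraph {m : ℕ} {T : Type*} (N : T → Finset (Fin m)) : SimpleGraph (Fin m ⊕ T) where
  Adj x y :=
    match x, y with
    | Sum.inl i, Sum.inl j => i ≠ j
    | Sum.inl i, Sum.inr t => i ∈ N t
    | Sum.inr t, Sum.inl i => i ∈ N t
    | Sum.inr _, Sum.inr _ => False
  symm := ⟨by
    rintro (i | u) (j | w) h
    · exact Ne.symm h
    · exact h
    · exact h
    · exact h⟩
  loopless := ⟨by
    rintro (i | u) h
    · exact h rfl
    · exact h⟩

/-- The degrees of the derivations attached to the vertices of a split graph. -/
def splitDegree {m : ℕ} {T : Type*} (N : T → Finset (Fin m)) : Fin m ⊕ T → ℕ :=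
  Sum.elim (fun i => i) fun t => (N t).card

/-- Both products are values of one polynomial, at `x` and at `z`. This is what puts the core
derivations into `D(A)`. -/
theorem sub_dvd_prod_sub_sub_prod_sub {R I : Type*} [CommRing R] (s : Finset I) (f : I → R)
    (x z : R) : x - z ∣ ∏ j ∈ s, (x - f j) - ∏ j ∈ s, (z - f j) := by
  classical
  induction s using Finset.induction_on with
  | empty => simp
  | insert a s ha ih =>
    rw [Finset.prod_insert ha, Finset.prod_insert ha]
    have : (x - f a) * ∏ j ∈ s, (x - f j) - (z - f a) * ∏ j ∈ s, (z - f j) =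
        (x - z) * ∏ j ∈ s, (x - f j) +
          (z - f a) * (∏ j ∈ s, (x - f j) - ∏ j ∈ s, (z - f j)) := by ring
    rw [this]
    exact dvd_add (dvd_mul_right _ _) (ih.mul_left _)

section SplitBasis

variable {K V ι : Type*} [Field K] [AddCommGroup V] [Module K V] [Fintype ι]
  (b : Module.Basis ι K V) {m : ℕ} {T : Type*} (N : T → Finset (Fin m))
  (y : Module.Basis (Fin m ⊕ T) K (Module.Dual K V))

theorem linearFormPoly_sub (α β : Module.Dual K V) :
    linearFormPoly b (α - β) = linearFormPoly b α - linearFormPoly b β :=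
  (linearFormPolyHom b).map_sub α β

open Classical in
/-- The values of the derivations attached to the vertices of a split graph on the coordinates. -/
noncomputable def splitValue : Fin m ⊕ T → Fin m ⊕ T → MvPolynomial ι K
  | Sum.inl i, w => ∏ j ∈ Finset.Iio i,
      (linearFormPoly b (y w) - linearFormPoly b (y (Sum.inl j)))
  | Sum.inr t, w => if w = Sum.inr t then ∏ j ∈ N t,
      (linearFormPoly b (y w) - linearFormPoly b (y (Sum.inl j))) else 0

theorem splitValue_inl (i : Fin m) (w : Fin m ⊕ T) :
    splitValue b N y (Sum.inl i) w =
      ∏ j ∈ Finset.Iio i, (linearFormPoly b (y w) - linearFormPoly b (y (Sum.inl j))) := rfl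

theorem splitValue_inr_self (t : T) :
    splitValue b N y (Sum.inr t) (Sum.inr t) =
      ∏ j ∈ N t, (linearFormPoly b (y (Sum.inr t)) - linearFormPoly b (y (Sum.inl j))) :=
  if_pos rfl

theorem splitValue_inr_of_ne {t : T} {w : Fin m ⊕ T} (h : w ≠ Sum.inr t) :
    splitValue b N y (Sum.inr t) w = 0 :=
  if_neg h

/-- The derivations attached to the vertices of a split graph. -/
noncomputable def splitDerivation (v : Fin m ⊕ T) :
    Derivation K (MvPolynomial ι K) (MvPolynomial ι K) :=
  derivationOfLinear b (y.constr K (splitValue b N y v))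

theorem splitDerivation_apply (v w : Fin m ⊕ T) :
    splitDerivation b N y v (linearFormPoly b (y w)) = splitValue b N y v w := by
  rw [splitDerivation, derivationOfLinear_linearFormPoly, Module.Basis.constr_basis]

theorem isHomogeneous_splitValue (v w : Fin m ⊕ T) :
    (splitValue b N y v w).IsHomogeneous (splitDegree N v) := by
  have h : ∀ j, (linearFormPoly b (y w) - linearFormPoly b (y j)).IsHomogeneous 1 := fun j =>
    (isHomogeneous_linearFormPoly b _).sub (isHomogeneous_linearFormPoly b _)
  rcases v with i | t
  · have := IsHomogeneous.prod (Finset.Iio i)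
      (fun j => linearFormPoly b (y w) - linearFormPoly b (y (Sum.inl j))) (fun _ => 1)
      fun j _ => h _
    simpa [splitDegree, splitValue] using this
  · have := IsHomogeneous.prod (N t)
      (fun j => linearFormPoly b (y w) - linearFormPoly b (y (Sum.inl j))) (fun _ => 1)
      fun j _ => h _
    by_cases hw : w = Sum.inr t
    · subst hw
      rw [splitValue_inr_self]
      simpa [splitDegree] using this
    · rw [splitValue_inr_of_ne b N y hw]
      exact isHomogeneous_zero _ _ _

theorem splitValue_inl_eq_zero {i : Fin m} {j : Fin m} (h : j < i) :
    splitValue b N y (Sum.inl i) (Sum.inl j) = 0 :=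
  Finset.prod_eq_zero (Finset.mem_Iio.2 h) (sub_self _)

theorem linearFormPoly_coord_sub_ne_zero {u w : Fin m ⊕ T} (h : u ≠ w) :
    linearFormPoly b (y u) - linearFormPoly b (y w) ≠ 0 := by
  rw [← linearFormPoly_sub, Ne, linearFormPoly_eq_zero_iff, sub_eq_zero]
  exact fun h' => h (y.injective h')

theorem splitValue_self_ne_zero (v : Fin m ⊕ T) : splitValue b N y v v ≠ 0 := by
  rcases v with i | t
  · refine Finset.prod_ne_zero_iff.2 fun j hj => linearFormPoly_coord_sub_ne_zero b y ?_
    simpa using (Finset.mem_Iio.1 hj).ne'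
  · rw [splitValue_inr_self]
    exact Finset.prod_ne_zero_iff.2 fun j hj => linearFormPoly_coord_sub_ne_zero b y (by simp)

theorem prod_coord_sub_dvd {s : Finset (Fin m)} {w : Fin m ⊕ T} {f : MvPolynomial ι K}
    (hw : ∀ j ∈ s, w ≠ Sum.inl j)
    (h : ∀ j ∈ s, linearFormPoly b (y w) - linearFormPoly b (y (Sum.inl j)) ∣ f) :
    ∏ j ∈ s, (linearFormPoly b (y w) - linearFormPoly b (y (Sum.inl j))) ∣ f := by
  classical
  refine Finset.prod_dvd_of_isRelPrime (fun j hj j' hj' hne => ?_) h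
  have hne0 : ∀ {u}, w ≠ u → y w - y u ≠ 0 := fun h h0 => h (y.injective (sub_eq_zero.1 h0))
  have hw1 := hw j hj
  have hw2 := hw j' hj'
  simp only [Function.onFun, ← linearFormPoly_sub]
  refine (prime_linearFormPoly b (hne0 hw1)).irreducible.isRelPrime_iff_not_dvd.2 fun hd => ?_
  obtain ⟨u, hu⟩ := (prime_linearFormPoly b (hne0 hw1)).irreducible.associated_of_dvd
    (prime_linearFormPoly b (hne0 hw2)).irreducible hd
  obtain ⟨c, hc, hcu⟩ := MvPolynomial.isUnit_iff_eq_C_of_isReduced.1 u.isUnit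
  have key : y w - y (Sum.inl j') = c • (y w - y (Sum.inl j)) :=
    linearFormPolyHom_injective b <| by
      rw [map_smul, smul_eq_C_mul, ← hcu, linearFormPolyHom_apply, linearFormPolyHom_apply, ← hu,
        mul_comm]
  -- Proportionality fails in the coordinate `j`, which occurs in only one of the two forms.
  have key' := congrArg (fun x => y.repr x (Sum.inl j)) key
  have hjj : (Sum.inl j : Fin m ⊕ T) ≠ Sum.inl j' := by simpa using hne
  simp [hw1, hjj.symm] at key'
  exact hc.ne_zero key'

theorem mem_derivationModule_split_iff {A : CentralArrangement K V}
    (hA : A.hyperplanes = {H | ∃ u w, (splitGraph N).Adj u w ∧ H = LinearMap.ker (y u - y w)})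
    {θ : Derivation K (MvPolynomial ι K) (MvPolynomial ι K)} :
    θ ∈ A.derivationModule b ↔ ∀ u w, (splitGraph N).Adj u w →
      linearFormPoly b (y u) - linearFormPoly b (y w) ∣
        θ (linearFormPoly b (y u)) - θ (linearFormPoly b (y w)) := by
  rw [A.mem_derivationModule_iff b
    (I := {p : (Fin m ⊕ T) × (Fin m ⊕ T) // (splitGraph N).Adj p.1 p.2})
    (α := fun p => y p.1.1 - y p.1.2)]
  · simp [linearFormPoly_sub]
  · rw [hA]
    ext H
    simp [eq_comm]
  · exact fun p h0 => p.2.ne (y.injective (sub_eq_zero.1 h0))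

/-- A core derivation applies one and the same polynomial to every coordinate, so differences are
divisible. An outer one is nonzero only at its own vertex `t`, with a value divisible by the form of
each edge at `t`. -/
theorem splitDerivation_mem {A : CentralArrangement K V}
    (hA : A.hyperplanes = {H | ∃ u w, (splitGraph N).Adj u w ∧ H = LinearMap.ker (y u - y w)})
    (v : Fin m ⊕ T) : splitDerivation b N y v ∈ A.derivationModule b := by
  rw [mem_derivationModule_split_iff b N y hA]
  intro u w huw
  rw [splitDerivation_apply, splitDerivation_apply]
  rcases v with i | t
  · rw [splitValue_inl, splitValue_inl]
    exact sub_dvd_prod_sub_sub_prod_sub _ _ _ _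
  · have key : ∀ w, (splitGraph N).Adj (Sum.inr t) w →
        linearFormPoly b (y (Sum.inr t)) - linearFormPoly b (y w) ∣
          splitValue b N y (Sum.inr t) (Sum.inr t) - splitValue b N y (Sum.inr t) w := by
      rintro (j | t') h
      · rw [splitValue_inr_self, splitValue_inr_of_ne b N y (by simp), sub_zero]
        exact Finset.dvd_prod_of_mem
          (fun j => linearFormPoly b (y (Sum.inr t)) - linearFormPoly b (y (Sum.inl j))) h
      · exact h.elim
    by_cases hu : u = Sum.inr t
    · subst hu
      exact key w huw
    by_cases hw : w = Sum.inr t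
    · subst hw
      rw [← neg_sub, neg_dvd, ← dvd_neg, neg_sub]
      exact key u huw.symm
    · rw [splitValue_inr_of_ne b N y hu, splitValue_inr_of_ne b N y hw, sub_zero]
      exact dvd_zero _

theorem linearIndependent_splitDerivation [Fintype T] :
    LinearIndependent (MvPolynomial ι K) (splitDerivation b N y) := by
  classical
  rw [Fintype.linearIndependent_iff]
  intro g hg
  have hev : ∀ x, ∑ v, g v * splitValue b N y v x = 0 := fun x => by
    have := congrArg (derivationEval (linearFormPoly b (y x))) hg
    rw [map_sum, map_zero] at this
    simpa only [map_smul, derivationEval_apply, splitDerivation_apply, smul_eq_mul] using this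
  have hsingle : ∀ x, (∀ v, v ≠ x → g v = 0 ∨ splitValue b N y v x = 0) → g x = 0 := by
    intro x hx
    have h := hev x
    rw [Finset.sum_eq_single x (fun v _ hv => mul_eq_zero.2 (hx v hv)) (by simp)] at h
    exact (mul_eq_zero.1 h).resolve_right (splitValue_self_ne_zero b N y x)
  -- On the core coordinates the outer derivations vanish and the core ones are triangular; the
  -- outer block is then diagonal.
  have hcore : ∀ i : Fin m, g (Sum.inl i) = 0 := by
    intro i
    induction i using WellFoundedLT.induction with
    | ind i ih =>
      refine hsingle _ ?_
      rintro (j | t) hv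
      · rcases lt_trichotomy j i with hji | rfl | hji
        · exact Or.inl (ih j hji)
        · exact (hv rfl).elim
        · exact Or.inr (splitValue_inl_eq_zero b N y hji)
      · exact Or.inr (splitValue_inr_of_ne b N y (by simp))
  rintro (i | t)
  · exact hcore i
  · refine hsingle _ ?_
    rintro (j | t') hv
    · exact Or.inl (hcore j)
    · exact Or.inr (splitValue_inr_of_ne b N y hv.symm)

theorem prod_coord_sub_dvd_apply {A : CentralArrangement K V}
    (hA : A.hyperplanes = {H | ∃ u w, (splitGraph N).Adj u w ∧ H = LinearMap.ker (y u - y w)})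
    {θ : Derivation K (MvPolynomial ι K) (MvPolynomial ι K)} (hθ : θ ∈ A.derivationModule b)
    {s : Finset (Fin m)} {w : Fin m ⊕ T} (hs : ∀ j ∈ s, (splitGraph N).Adj w (Sum.inl j))
    (hs0 : ∀ j ∈ s, θ (linearFormPoly b (y (Sum.inl j))) = 0) :
    ∏ j ∈ s, (linearFormPoly b (y w) - linearFormPoly b (y (Sum.inl j))) ∣
      θ (linearFormPoly b (y w)) :=
  prod_coord_sub_dvd b y (fun j hj => (hs j hj).ne) fun j hj => by
    have := (mem_derivationModule_split_iff b N y hA).1 hθ _ _ (hs j hj)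
    rwa [hs0 j hj, sub_zero] at this

/-- Gaussian elimination along the core: `θ` may be nonzero only on the last `q` core coordinates.
If it vanishes on the whole core, its value at each outer `t` is divisible by the product over `N
t`, which gives the coefficients. -/
theorem mem_span_splitDerivation_of_vanish [Fintype T] {A : CentralArrangement K V}
    (hA : A.hyperplanes = {H | ∃ u w, (splitGraph N).Adj u w ∧ H = LinearMap.ker (y u - y w)})
    (q : ℕ) {θ : Derivation K (MvPolynomial ι K) (MvPolynomial ι K)}
    (hθ : θ ∈ A.derivationModule b)
    (h : ∀ j : Fin m, (j : ℕ) + q < m → θ (linearFormPoly b (y (Sum.inl j))) = 0) :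
    θ ∈ Submodule.span (MvPolynomial ι K) (Set.range (splitDerivation b N y)) := by
  classical
  induction q generalizing θ with
  | zero =>
    have hc : ∀ j : Fin m, θ (linearFormPoly b (y (Sum.inl j))) = 0 := fun j => h j j.2
    choose c hc' using fun t : T => 
      prod_coord_sub_dvd_apply b N y hA hθ (s := N t) (w := Sum.inr t) (fun j hj => hj)
        fun j _ => hc j
    have : θ = ∑ t, c t • splitDerivation b N y (Sum.inr t) := by
      refine derivation_ext_of_dual_basis b y fun w => ?_
      change _ = derivationEval (linearFormPoly b (y w)) _
      rw [map_sum]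
      simp only [map_smul, derivationEval_apply, splitDerivation_apply, smul_eq_mul]
      rcases w with j | t
      · rw [hc, Finset.sum_eq_zero]
        exact fun t _ => by rw [splitValue_inr_of_ne b N y (by simp), mul_zero]
      · rw [Finset.sum_eq_single t (fun t' _ ht' => by
          rw [splitValue_inr_of_ne b N y (by simpa using ht'.symm), mul_zero]) (by simp),
          splitValue_inr_self, hc', mul_comm]
    rw [this]
    exact Submodule.sum_mem _ fun t _ =>
      Submodule.smul_mem _ _ (Submodule.subset_span ⟨_, rfl⟩)
  | succ q ih =>
    by_cases hq : q + 1 ≤ m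
    -- The first core coordinate where `θ` may be nonzero. Vanishing at all earlier ones makes the
    -- value there a multiple of the diagonal entry, which is then subtracted.
    · let i : Fin m := ⟨m - (q + 1), by lia⟩
      obtain ⟨c, hc⟩ := prod_coord_sub_dvd_apply b N y hA hθ (s := Finset.Iio i)
        (w := Sum.inl i) (fun j hj => (Finset.mem_Iio.1 hj).ne') fun j hj => h j (by
          have hji : j < i := Finset.mem_Iio.1 hj
          have : (j : ℕ) < m - (q + 1) := hji
          lia)
      have hmem := splitDerivation_mem b N y hA (Sum.inl i)
      have hsub : θ - c • splitDerivation b N y (Sum.inl i) ∈ A.derivationModule b :=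
        Submodule.sub_mem _ hθ (Submodule.smul_mem _ c hmem)
      have := ih hsub (fun j hj => by
        rw [Derivation.sub_apply, Derivation.smul_apply, splitDerivation_apply, smul_eq_mul]
        rcases lt_trichotomy j i with hji | rfl | hji
        · rw [splitValue_inl_eq_zero b N y hji, mul_zero, sub_zero]
          refine h j ?_
          have : (j : ℕ) < m - (q + 1) := hji
          lia
        · rw [hc, splitValue_inl, mul_comm, sub_self]
        · have : m - (q + 1) < (j : ℕ) := hji
          lia)
      rw [← sub_add_cancel θ (c • splitDerivation b N y (Sum.inl i))]
      exact Submodule.add_mem _ this (Submodule.smul_mem _ _ (Submodule.subset_span ⟨_, rfl⟩))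
    · exact ih hθ (fun j hj => by lia)

/-- The basis of the derivation module of the arrangement of a split graph. -/
noncomputable def splitBasis [Fintype T] {A : CentralArrangement K V}
    (hA : A.hyperplanes = {H | ∃ u w, (splitGraph N).Adj u w ∧ H = LinearMap.ker (y u - y w)}) :
    Module.Basis (Fin m ⊕ T) (MvPolynomial ι K) (A.derivationModule b) :=
  Module.Basis.mk (v := fun v => ⟨splitDerivation b N y v, splitDerivation_mem b N y hA v⟩)
    (LinearIndependent.of_comp (A.derivationModule b).subtype
      (linearIndependent_splitDerivation b N y)) (by
    rintro ⟨θ, hθ⟩ -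
    have := mem_span_splitDerivation_of_vanish b N y hA m hθ fun j hj => by lia
    have hr : Set.range (splitDerivation b N y) = (A.derivationModule b).subtype ''
        Set.range fun v => ⟨splitDerivation b N y v, splitDerivation_mem b N y hA v⟩ := by
      rw [← Set.range_comp]
      rfl
    rw [hr, ← Submodule.map_span] at this
    obtain ⟨η, hη, rfl⟩ := this
    exact hη)

theorem isHomogeneous_splitBasis [Fintype T] {A : CentralArrangement K V}
    (hA : A.hyperplanes = {H | ∃ u w, (splitGraph N).Adj u w ∧ H = LinearMap.ker (y u - y w)})
    (v : Fin m ⊕ T) (j : ι) :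
    ((splitBasis b N y hA v : Derivation K (MvPolynomial ι K) (MvPolynomial ι K))
      (X j)).IsHomogeneous (splitDegree N v) := by
  rw [splitBasis, Module.Basis.mk_apply]
  exact isHomogeneous_apply_X_of_dual_basis b y (fun w => by
    rw [splitDerivation_apply]
    exact isHomogeneous_splitValue b N y v w) j

end SplitBasis

/-- The exponents of the arrangement of a split graph. -/
theorem freeWithExponents_split_iff {K V : Type*} [Field K] [AddCommGroup V] [Module K V]
    [FiniteDimensional K V] {m : ℕ} {T : Type*} [Fintype T] (N : T → Finset (Fin m))
    (y : Module.Basis (Fin m ⊕ T) K (Module.Dual K V)) {A : CentralArrangement K V}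
    (hA : A.hyperplanes = {H | ∃ u w, (splitGraph N).Adj u w ∧ H = LinearMap.ker (y u - y w)})
    {n : ℕ} (hn : Module.finrank K V = n) (e : Fin n → ℕ) :
    A.FreeWithExponents e ↔ ∀ p, (Finset.univ.filter fun i => e i = p).card =
      (Finset.univ.filter fun w => splitDegree N w = p).card := by
  constructor
  · rintro ⟨b, θ, hθ⟩ p
    exact card_degree_eq θ hθ (splitBasis b N y hA) (isHomogeneous_splitBasis b N y hA) p
  · intro h
    -- Equal fibre sizes give a degree-preserving bijection, along which the explicit basis is
    -- reindexed.
    have hcard : ∀ p, Nonempty ({i // e i = p} ≃ {w // splitDegree N w = p}) := fun p => by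
      rw [← Fintype.card_eq, Fintype.card_subtype, Fintype.card_subtype, h p]
    let σ : Fin n ≃ (Fin m ⊕ T) := Equiv.ofFiberEquiv fun p => (hcard p).some
    have hσ : ∀ i, splitDegree N (σ i) = e i := fun i => Equiv.ofFiberEquiv_map _ i
    let b := Module.finBasisOfFinrankEq K V hn
    refine ⟨b, (splitBasis b N y hA).reindex σ.symm, fun i j => ?_⟩
    rw [Module.Basis.reindex_apply, Equiv.symm_symm, ← hσ i]
    exact isHomogeneous_splitBasis b N y hA (σ i) j

/-! ### Contractions of split graphs and restrictions to the corresponding flats -/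

section SplitFlat

variable (K : Type*) [Field K] {U : Type*} {n m : ℕ} {T : Type*} {N : T → Finset (Fin n)}
  {G : SimpleGraph U} (φ : splitGraph N ≃g G) (κ : Fin n → Fin m) (F : T → Prop)
  (p : T → Fin n)

/-- The subspace of functions on the vertices of a split graph which are constant on the fibres of
`κ` in the complete graph, and take the same value at `t` and `p t` for `t` outside `F`. -/
def splitFlat : Submodule K (U → K) where
  carrier := {f | (∀ i j, κ i = κ j → f (φ (Sum.inl i)) = f (φ (Sum.inl j))) ∧
    ∀ t, ¬ F t → f (φ (Sum.inr t)) = f (φ (Sum.inl (p t)))}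
  add_mem' {f g} hf hg := ⟨fun i j h => by simp [hf.1 i j h, hg.1 i j h],
    fun t ht => by simp [hf.2 t ht, hg.2 t ht]⟩
  zero_mem' := by simp
  smul_mem' c f hf := ⟨fun i j h => by simp [hf.1 i j h], fun t ht => by simp [hf.2 t ht]⟩

theorem splitFlat_mono {m' : ℕ} {κ' : Fin n → Fin m'} {F' : T → Prop}
    (hκ : ∀ i j, κ' i = κ' j → κ i = κ j) (hF : ∀ t, F t → F' t) :
    splitFlat K φ κ F p ≤ splitFlat K φ κ' F' p :=
  fun _ hf => ⟨fun i j h => hf.1 i j (hκ i j h), fun t ht => hf.2 t fun h => ht (hF t h)⟩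

/-- Every defining equation comes from an edge: the core is complete, and `t` is adjacent to `p t`.
-/
theorem isFlat_splitFlat [Finite U] (hp : ∀ t, p t ∈ N t) :
    (graphicArrangement K G).IsFlat (splitFlat K φ κ F p) := by
  refine ⟨{H | H ∈ (graphicArrangement K G).hyperplanes ∧ splitFlat K φ κ F p ≤ H},
    fun H h => h.1, le_antisymm (le_sInf fun H h => h.2) fun f hf => ?_⟩
  have key : ∀ x z, (splitGraph N).Adj x z → (∀ g ∈ splitFlat K φ κ F p, g (φ x) = g (φ z)) →
      f (φ x) = f (φ z) := by
    intro x z hxz h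
    have := (Submodule.mem_sInf.1 hf) (LinearMap.ker
      ((LinearMap.proj (φ x) : (U → K) →ₗ[K] K) - (LinearMap.proj (φ z) : (U → K) →ₗ[K] K)))
      ⟨⟨φ x, φ z, φ.map_adj_iff.2 hxz, rfl⟩, fun g hg => by simp [h g hg]⟩
    simpa [sub_eq_zero] using this
  refine ⟨fun i j h => ?_, fun t ht => key _ _ (hp t) fun g hg => hg.2 t ht⟩
  rcases eq_or_ne i j with rfl | hij
  · rfl
  · exact key _ _ hij fun g hg => hg.1 i j h

open Classical in
/-- The vertex of the contracted split graph to which a vertex is contracted. -/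
noncomputable def splitRetract : Fin n ⊕ T → Fin m ⊕ {t // F t}
  | Sum.inl i => Sum.inl (κ i)
  | Sum.inr t => if h : F t then Sum.inr ⟨t, h⟩ else Sum.inl (κ (p t))

theorem splitRetract_inl (i : Fin n) : splitRetract κ F p (Sum.inl i) = Sum.inl (κ i) := rfl

theorem splitRetract_inr_of_mem {t : T} (h : F t) :
    splitRetract κ F p (Sum.inr t) = Sum.inr ⟨t, h⟩ := dif_pos h

theorem splitRetract_inr_of_not_mem {t : T} (h : ¬ F t) :
    splitRetract κ F p (Sum.inr t) = Sum.inl (κ (p t)) := dif_neg h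

-- Split graphs are closed under these contractions: an absorbed outer vertex lands in the core,
-- where its surviving edges are core edges already, and a kept one sees the image of its
-- neighbourhood.
open Classical in
theorem splitGraph_image_adj_iff (hκ : Function.Surjective κ)
    (u w : Fin m ⊕ {t // F t}) :
    (splitGraph fun t : {t // F t} => (N t).image κ).Adj u w ↔
      u ≠ w ∧ ∃ x z, (splitGraph N).Adj x z ∧ splitRetract κ F p x = u ∧
        splitRetract κ F p z = w := by
  constructor
  · intro h
    refine ⟨h.ne, ?_⟩
    rcases u with a | t <;> rcases w with c | t'
    · obtain ⟨i, rfl⟩ := hκ a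
      obtain ⟨j, rfl⟩ := hκ c
      exact ⟨Sum.inl i, Sum.inl j, fun hij => h (congrArg κ hij), rfl, rfl⟩
    · obtain ⟨i, hi, rfl⟩ := Finset.mem_image.1 (show a ∈ (N t').image κ from h)
      exact ⟨Sum.inl i, Sum.inr t', hi, rfl, splitRetract_inr_of_mem _ _ _ t'.2⟩
    · obtain ⟨i, hi, rfl⟩ := Finset.mem_image.1 (show c ∈ (N t).image κ from h)
      exact ⟨Sum.inr t, Sum.inl i, hi, splitRetract_inr_of_mem _ _ _ t.2, rfl⟩
    · exact h.elim
  · rintro ⟨hne, x, z, hxz, rfl, rfl⟩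
    have core : ∀ a c : Fin m, (Sum.inl a : Fin m ⊕ {t // F t}) ≠ Sum.inl c →
        (splitGraph fun t : {t // F t} => (N t).image κ).Adj (Sum.inl a) (Sum.inl c) :=
      fun a c h h' => h (congrArg Sum.inl h')
    have side : ∀ i t, i ∈ N t →
        splitRetract κ F p (Sum.inl i) ≠ splitRetract κ F p (Sum.inr t) →
        (splitGraph fun t : {t // F t} => (N t).image κ).Adj
          (splitRetract κ F p (Sum.inl i)) (splitRetract κ F p (Sum.inr t)) := by
      intro i t hi hne
      by_cases h : F t
      · rw [splitRetract_inr_of_mem κ F p h]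
        exact Finset.mem_image_of_mem κ hi
      · rw [splitRetract_inr_of_not_mem κ F p h] at hne ⊢
        exact core _ _ hne
    rcases x with i | t <;> rcases z with j | t'
    · exact core _ _ hne
    · exact side i t' hxz hne
    · exact (side j t hxz hne.symm).symm
    · exact hxz.elim

/-- The coordinates of the flat `splitFlat`. -/
noncomputable def splitFlatEquiv (hκ : Function.Surjective κ) :
    splitFlat K φ κ F p ≃ₗ[K] (Fin m ⊕ {t // F t} → K) where
  toFun f w := (f : U → K) (φ (Sum.map (Function.surjInv hκ) Subtype.val w))
  map_add' _ _ := rfl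
  map_smul' _ _ := rfl
  invFun g := ⟨fun u => g (splitRetract κ F p (φ.symm u)),
    fun i j h => by simp [splitRetract_inl, h], fun t ht => by
      simp [splitRetract_inl, splitRetract_inr_of_not_mem κ F p ht]⟩
  left_inv f := by
    ext u
    obtain ⟨x, rfl⟩ := φ.surjective u
    simp only [RelIso.symm_apply_apply]
    rcases x with i | t
    · exact f.2.1 _ _ (Function.surjInv_eq hκ _)
    · by_cases h : F t
      · rw [splitRetract_inr_of_mem κ F p h]
        rfl
      · rw [splitRetract_inr_of_not_mem κ F p h, f.2.2 t h]
        exact f.2.1 _ _ (Function.surjInv_eq hκ _)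
  right_inv g := by
    ext w
    rcases w with a | t
    · simp [splitRetract_inl, Function.surjInv_eq hκ]
    · simp [splitRetract_inr_of_mem κ F p t.2]

theorem splitFlatEquiv_apply_retract (hκ : Function.Surjective κ) (f : splitFlat K φ κ F p)
    (x : Fin n ⊕ T) :
    splitFlatEquiv K φ κ F p hκ f (splitRetract κ F p x) = (f : U → K) (φ x) := by
  conv_rhs => rw [← (splitFlatEquiv K φ κ F p hκ).symm_apply_apply f]
  change _ = splitFlatEquiv K φ κ F p hκ f (splitRetract κ F p (φ.symm (φ x)))
  rw [RelIso.symm_apply_apply]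

theorem finrank_splitFlat [Fintype T] [DecidablePred F] (hκ : Function.Surjective κ) :
    Module.finrank K (splitFlat K φ κ F p) = m + (Finset.univ.filter F).card := by
  rw [(splitFlatEquiv K φ κ F p hκ).finrank_eq, Module.finrank_fintype_fun_eq_card,
    Fintype.card_sum, Fintype.card_fin, Fintype.card_subtype]

open Classical in
/-- The restriction of the graphic arrangement to `splitFlat` is the arrangement of the contracted
split graph. -/
theorem hyperplanes_restrict_splitFlat [Finite U] [Finite T] (hκ : Function.Surjective κ) :
    ((graphicArrangement K G).restrict (splitFlat K φ κ F p)).hyperplanes =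
      {H | ∃ u w, (splitGraph fun t : {t // F t} => (N t).image κ).Adj u w ∧
        H = LinearMap.ker
          ((Module.Basis.ofEquivFun (splitFlatEquiv K φ κ F p hκ)).dualBasis u -
            (Module.Basis.ofEquivFun (splitFlatEquiv K φ κ F p hκ)).dualBasis w)} := by
  set X := splitFlat K φ κ F p
  set B := Module.Basis.ofEquivFun (splitFlatEquiv K φ κ F p hκ) with hB
  have hy : ∀ x (f : X), B.dualBasis (splitRetract κ F p x) f = (f : U → K) (φ x) := by
    intro x f
    rw [← splitFlatEquiv_apply_retract K φ κ F p hκ f x]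
    simp [hB]
  have hker : ∀ x z, (LinearMap.ker ((LinearMap.proj (φ x) : (U → K) →ₗ[K] K) -
      (LinearMap.proj (φ z) : (U → K) →ₗ[K] K))).comap X.subtype =
      LinearMap.ker (B.dualBasis (splitRetract κ F p x) - B.dualBasis (splitRetract κ F p z)) := by
    intro x z
    ext f
    rw [LinearMap.mem_ker, LinearMap.sub_apply, hy, hy]
    rfl
  ext H
  constructor
  · rintro ⟨_, ⟨⟨i, j, hij, rfl⟩, hX⟩, rfl⟩
    obtain ⟨x, rfl⟩ := φ.surjective i
    obtain ⟨z, rfl⟩ := φ.surjective j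
    refine ⟨_, _, (splitGraph_image_adj_iff κ F p hκ _ _).2
      ⟨fun h => hX ?_, x, z, φ.map_adj_iff.1 hij, rfl, rfl⟩, hker x z⟩
    intro f hf
    have h1 := hy x ⟨f, hf⟩
    have h2 := hy z ⟨f, hf⟩
    rw [h] at h1
    simpa [sub_eq_zero] using h1.symm.trans h2
  · rintro ⟨u, w, huw, rfl⟩
    obtain ⟨hne, x, z, hxz, rfl, rfl⟩ := (splitGraph_image_adj_iff κ F p hκ _ _).1 huw
    refine ⟨_, ⟨⟨φ x, φ z, φ.map_adj_iff.2 hxz, rfl⟩, fun hX => hne ?_⟩, hker x z⟩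
    have htop := hker x z
    rw [Submodule.comap_subtype_eq_top.2 hX, eq_comm, LinearMap.ker_eq_top, sub_eq_zero] at htop
    exact B.dualBasis.injective htop

theorem freeWithExponents_restrict_splitFlat_iff [Finite U] [Fintype T] [DecidablePred F]
    (hκ : Function.Surjective κ) {d : ℕ}
    (hd : Module.finrank K (splitFlat K φ κ F p) = d) (e : Fin d → ℕ) :
    ((graphicArrangement K G).restrict (splitFlat K φ κ F p)).FreeWithExponents e ↔
      ∀ q, (Finset.univ.filter fun i => e i = q).card = (Finset.univ.filter fun w =>
        splitDegree (fun t : {t // F t} => (N t).image κ) w = q).card :=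
  freeWithExponents_split_iff _ _ (hyperplanes_restrict_splitFlat K φ κ F p hκ) hd e

theorem freeWithExponents_graphicArrangement_iff [Fintype U] [Fintype T]
    (φ : splitGraph N ≃g G) {d : ℕ}
    (hd : Module.finrank K (U → K) = d) (e : Fin d → ℕ) :
    (graphicArrangement K G).FreeWithExponents e ↔
      ∀ q, (Finset.univ.filter fun i => e i = q).card =
        (Finset.univ.filter fun w => splitDegree N w = q).card := by
  classical
  refine freeWithExponents_split_iff N
    ((Pi.basisFun K U).reindex φ.toEquiv.symm).dualBasis ?_ hd e
  have hy : ∀ x, ((Pi.basisFun K U).reindex φ.toEquiv.symm).dualBasis x =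
      (LinearMap.proj (φ x) : (U → K) →ₗ[K] K) := fun x => by
    refine LinearMap.ext fun f => ?_
    simp
  ext H
  simp only [hy]
  constructor
  · rintro ⟨i, j, hij, rfl⟩
    obtain ⟨x, rfl⟩ := φ.surjective i
    obtain ⟨z, rfl⟩ := φ.surjective j
    exact ⟨x, z, φ.map_adj_iff.1 hij, rfl⟩
  · rintro ⟨x, z, h, rfl⟩
    exact ⟨φ x, φ z, φ.map_adj_iff.2 h, rfl⟩

end SplitFlat

/-! ### Counting vertices by degree -/

section Counting

theorem card_filter_sum_type {α β : Type*} [Fintype α] [Fintype β] (P : α ⊕ β → Prop)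
    [DecidablePred P] : (Finset.univ.filter P).card =
      (Finset.univ.filter fun a => P (Sum.inl a)).card +
        (Finset.univ.filter fun c => P (Sum.inr c)).card := by
  simp only [Finset.card_filter, Fintype.sum_sum_type]

theorem card_filter_subtype {α : Type*} [Fintype α] (F P : α → Prop) [DecidablePred F]
    [DecidablePred P] : (Finset.univ.filter fun a : {a // F a} => P a).card =
      (Finset.univ.filter fun a => F a ∧ P a).card := by
  rw [← Finset.card_map (Function.Embedding.subtype F)]
  congr 1
  ext a
  simp [and_comm]

theorem card_filter_fin_val_eq (m q : ℕ) :
    (Finset.univ.filter fun i : Fin m => (i : ℕ) = q).card = if q < m then 1 else 0 := by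
  split_ifs with h
  · rw [Finset.card_eq_one]
    exact ⟨⟨q, h⟩, by ext i; simp [Fin.ext_iff]⟩
  · rw [Finset.card_eq_zero]
    ext i
    simp
    lia

theorem card_filter_splitDegree {m : ℕ} {T : Type*} [Fintype T] (N : T → Finset (Fin m)) (q : ℕ) :
    (Finset.univ.filter fun w => splitDegree N w = q).card =
      (if q < m then 1 else 0) + (Finset.univ.filter fun t => (N t).card = q).card := by
  rw [card_filter_sum_type, ← card_filter_fin_val_eq m q]
  rfl

end Counting

/-! ### The graph `extendedQFour k` and its exponents -/

section ExtendedQFour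

variable (k : ℕ)

/-- The vertices of `extendedQFour k` outside the inner complete graph. -/
abbrev OuterVertex : Type := (Σ _ : InnerEdge 4, Fin k) ⊕ Fin k

/-- The neighbours of the outer vertices. -/
def outerNeighbors : OuterVertex k → Finset (Fin 4)
  | Sum.inl u => {u.1.1.1, u.1.1.2}
  | Sum.inr _ => {0, 1, 2}

/-- A neighbour of an outer vertex. -/
def outerParent : OuterVertex k → Fin 4
  | Sum.inl u => u.1.1.1
  | Sum.inr _ => 0

theorem outerParent_mem (t : OuterVertex k) : outerParent k t ∈ outerNeighbors k t := by
  rcases t with u | v <;> simp [outerParent, outerNeighbors]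

/-- The graph `extendedQFour k` as a split graph. -/
def extendedQFourIso : splitGraph (outerNeighbors k) ≃g extendedQFour k where
  toEquiv := (Equiv.sumAssoc _ _ _).symm
  map_rel_iff' := by
    have h3 : ∀ i : Fin 4, i ≠ 3 ↔ i ∈ ({0, 1, 2} : Finset (Fin 4)) := by decide
    rintro (i | u | v) (j | w | v')
    · exact Iff.rfl
    · simp [splitGraph, extendedQFour, qGraph, outerNeighbors]
    · exact h3 i
    · simp [splitGraph, extendedQFour, qGraph, outerNeighbors]
    · exact Iff.rfl
    · exact Iff.rfl
    · exact h3 j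
    · exact Iff.rfl
    · exact Iff.rfl

theorem finrank_extendedQFour (K : Type*) [Field K] :
    Module.finrank K (QVertex 4 (fun _ => k) ⊕ Fin k → K) = 7 * k + 4 := by
  have : Fintype.card (InnerEdge 4) = 6 := by decide
  simp [this]
  lia

/-- The exponents of the arrangement of `extendedQFour k`, in increasing order. -/
def extendedQFourExponent (i : ℕ) : ℕ :=
  if i = 0 then 0 else if i = 1 then 1 else if i < 6 * k + 3 then 2 else 3

theorem extendedQFourExponent_monotone : Monotone (extendedQFourExponent k) := by
  intro i j h
  unfold extendedQFourExponent
  split_ifs <;> lia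

/-- Each value is taken on an interval of indices; `min` and truncated subtraction account for small
`d`. -/
theorem card_filter_extendedQFourExponent (d q : ℕ) :
    (Finset.univ.filter fun i : Fin d => extendedQFourExponent k i = q).card =
      if q = 0 then min d 1 else if q = 1 then min d 2 - 1 else
        if q = 2 then min d (6 * k + 3) - 2 else if q = 3 then d - (6 * k + 3) else 0 := by
  have key : ∀ a c : ℕ, (∀ i, i < d ∧ extendedQFourExponent k i = q ↔ a ≤ i ∧ i < c) →
      (Finset.univ.filter fun i : Fin d => extendedQFourExponent k i = q).card = c - a := by
    intro a c h
    rw [← Nat.card_Ico, ← Finset.card_map Fin.valEmbedding]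
    congr 1
    ext i
    rw [Finset.mem_Ico, ← h]
    simp only [Finset.mem_map, Finset.mem_filter, Finset.mem_univ, true_and]
    exact ⟨fun ⟨j, hj, e⟩ => e ▸ ⟨j.2, hj⟩, fun ⟨h1, h2⟩ => ⟨⟨i, h1⟩, h2, rfl⟩⟩
  unfold extendedQFourExponent at key ⊢
  split_ifs with h0 h1 h2 h3
  · rw [key 0 (min d 1)]
    · lia
    · intro i; split_ifs <;> lia
  · rw [key 1 (min d 2)]
    intro i; split_ifs <;> lia
  · rw [key 2 (min d (6 * k + 3))]
    intro i; split_ifs <;> lia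
  · rw [key (6 * k + 3) d]
    intro i; split_ifs <;> lia
  · rw [key 0 0]
    intro i; split_ifs <;> lia

theorem card_filter_sigma (P : InnerEdge 4 → Prop) [DecidablePred P] :
    (Finset.univ.filter fun u : Σ _ : InnerEdge 4, Fin k => P u.1).card =
      (Finset.univ.filter P).card * k := by
  rw [Finset.card_filter, Finset.card_filter, Fintype.sum_sigma, Finset.sum_mul]
  refine Finset.sum_congr rfl fun e _ => ?_
  split_ifs <;> simp

variable (K : Type*) [Field K]

/-- A criterion for the exponents of the restriction to a flat to be the first exponents. -/
theorem restrict_splitFlat_freeWithExponents {m : ℕ} {κ : Fin 4 → Fin m}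
    (hκ : Function.Surjective κ) (F : OuterVertex k → Prop) [DecidablePred F] {d : ℕ}
    (hd : Module.finrank K (splitFlat K (extendedQFourIso k) κ F (outerParent k)) = d)
    (h : ∀ q, (Finset.univ.filter fun i : Fin d => extendedQFourExponent k i = q).card =
      (if q < m then 1 else 0) +
        (Finset.univ.filter fun t => F t ∧ ((outerNeighbors k t).image κ).card = q).card) :
    ((graphicArrangement K (extendedQFour k)).restrict
      (splitFlat K (extendedQFourIso k) κ F (outerParent k))).FreeWithExponents
        fun i : Fin d => extendedQFourExponent k i := by
  rw [freeWithExponents_restrict_splitFlat_iff K (extendedQFourIso k) κ F (outerParent k) hκ hd]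
  intro q
  rw [h q, card_filter_splitDegree,
    card_filter_subtype F fun t => ((outerNeighbors k t).image κ).card = q]

/-- The core gives `0, 1, 2, 3`, the `6k` tips give twos and the `k` vertices `v_i` give threes. -/
theorem extendedQFour_freeWithExponents :
    (graphicArrangement K (extendedQFour k)).FreeWithExponents
      fun i : Fin (Module.finrank K (QVertex 4 (fun _ => k) ⊕ Fin k → K)) =>
        extendedQFourExponent k i := by
  classical
  rw [freeWithExponents_graphicArrangement_iff K (extendedQFourIso k) rfl]
  intro q
  have h2 : ∀ e : InnerEdge 4, ({e.1.1, e.1.2} : Finset (Fin 4)).card = 2 := by decide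
  have h6 : Fintype.card (InnerEdge 4) = 6 := by decide
  rw [card_filter_splitDegree, card_filter_extendedQFourExponent, card_filter_sum_type,
    finrank_extendedQFour]
  simp only [outerNeighbors, h2]
  by_cases hq2 : q = 2
  · subst hq2
    simp [h6]
    lia
  · by_cases hq3 : q = 3
    · subst hq3
      simp
      lia
    · simp [Ne.symm hq2]
      simp [Ne.symm hq3]
      split_ifs <;> lia

end ExtendedQFour

theorem card_filter_congr {α : Type*} [Fintype α] {P Q : α → Prop} [DecidablePred P]
    [DecidablePred Q] (h : ∀ a, P a ↔ Q a) :
    (Finset.univ.filter P).card = (Finset.univ.filter Q).card :=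
  congrArg Finset.card (Finset.filter_congr fun a _ => h a)

/-! ### A witness whose first `6k + 3` members form a flag -/

section Witness

variable (k : ℕ)

/-- The outer vertices which do not become pendant when the inner vertices `0` and `1` are
identified. -/
def IsPersistent : OuterVertex k → Prop
  | Sum.inl u => u.1 ≠ ⟨(0, 1), by decide⟩
  | Sum.inr _ => True

-- The `5k` tips over the five other edges, and the `k` vertices `v_i`.
open Classical in
theorem card_isPersistent : Fintype.card {t // IsPersistent k t} = 6 * k := by
  have h5 : (Finset.univ.filter fun e : InnerEdge 4 => e ≠ ⟨(0, 1), by decide⟩).card = 5 := by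
    decide
  rw [Fintype.card_subtype, card_filter_sum_type,
    card_filter_congr (P := fun u => IsPersistent k (Sum.inl u))
      (Q := fun u => u.1 ≠ ⟨(0, 1), by decide⟩)
      fun _ => Iff.rfl,
    card_filter_congr (P := fun v => IsPersistent k (Sum.inr v)) (Q := fun _ => True) fun _ => Iff.rfl,
    card_filter_sigma k fun e => e ≠ ⟨(0, 1), by decide⟩, h5]
  simp
  lia

open Classical in
/-- A numbering of the persistent outer vertices. -/
noncomputable def persistentIndex : {t // IsPersistent k t} ≃ Fin (6 * k) :=
  Fintype.equivFinOfCardEq (card_isPersistent k)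

/-- The outer vertices of the member of dimension `d` of the flag. -/
def lowOuter (d : ℕ) (t : OuterVertex k) : Prop :=
  -- The contracted core accounts for three dimensions, so no outer vertex is kept for `d ≤ 3` and
  -- exactly one more enters at each later step.
  ∃ h : IsPersistent k t, (persistentIndex k ⟨t, h⟩ : ℕ) + 3 < d

/-- The outer vertices of the members of high dimension of the witness. -/
def highOuter (d : ℕ) : OuterVertex k → Prop
  | Sum.inl _ => True
  | Sum.inr v => (v : ℕ) + (6 * k + 4) < d

open Classical in
theorem card_lowOuter {d : ℕ} (hd : d ≤ 6 * k + 3) :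
    (Finset.univ.filter (lowOuter k d)).card = d - 3 := by
  have h1 : (Finset.univ.filter fun i : Fin (6 * k) => (i : ℕ) < d - 3).card = d - 3 := by
    rw [← Finset.card_map Fin.valEmbedding]
    conv_rhs => rw [← Finset.card_range (d - 3)]
    congr 1
    ext i
    simp only [Finset.mem_map, Finset.mem_filter, Finset.mem_univ, true_and, Finset.mem_range]
    exact ⟨fun ⟨j, hj, e⟩ => e ▸ hj, fun h => ⟨⟨i, by lia⟩, h, rfl⟩⟩
  rw [← h1]
  refine Finset.card_bij' (fun t ht => persistentIndex k ⟨t, (Finset.mem_filter.1 ht).2.1⟩)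
    (fun i _ => ((persistentIndex k).symm i).1) ?_ ?_ ?_ ?_
  · intro t ht
    obtain ⟨h, h'⟩ := (Finset.mem_filter.1 ht).2
    simp
    lia
  · intro i hi
    have := (Finset.mem_filter.1 hi).2
    refine Finset.mem_filter.2 ⟨Finset.mem_univ _, ((persistentIndex k).symm i).2, ?_⟩
    simp
    lia
  · intro t ht
    simp
  · intro i hi
    simp

open Classical in
/-- A witness for the accuracy of the arrangement of `extendedQFour k`. -/
noncomputable def accuracyWitness (K : Type*) [Field K] (d : ℕ) :
    Submodule K (QVertex 4 (fun _ => k) ⊕ Fin k → K) :=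
  if d ≤ 1 then
    splitFlat K (extendedQFourIso k) (fun _ => (0 : Fin 1)) (lowOuter k d) (outerParent k)
  else if d ≤ 2 then
    splitFlat K (extendedQFourIso k) (![0, 0, 1, 0] : Fin 4 → Fin 2) (lowOuter k d) (outerParent k)
  else if d ≤ 6 * k + 3 then
    -- Both `0` and `1` are neighbours of every `v_i`, so this identification lowers the degree of
    -- `v_i` from 3 to 2.
    splitFlat K (extendedQFourIso k) (![0, 0, 1, 2] : Fin 4 → Fin 3) (lowOuter k d) (outerParent k)
  else
    splitFlat K (extendedQFourIso k) (id : Fin 4 → Fin 4) (highOuter k d) (outerParent k)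

/-- As the dimension grows, the partition of the core gets finer and the set of kept outer vertices
larger. -/
theorem isFlagUpTo_accuracyWitness (K : Type*) [Field K] :
    CentralArrangement.IsFlagUpTo (accuracyWitness k K) (6 * k + 3) := by
  intro c d _ hcd hd
  have hF : ∀ t, lowOuter k c t → lowOuter k d t := fun t ⟨h, h'⟩ => ⟨h, by lia⟩
  have h23 : ∀ i j : Fin 4, (![0, 0, 1, 2] : Fin 4 → Fin 3) i = (![0, 0, 1, 2] : Fin 4 → Fin 3) j →
    (![0, 0, 1, 0] : Fin 4 → Fin 2) i = (![0, 0, 1, 0] : Fin 4 → Fin 2) j := by decide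
  unfold accuracyWitness
  split_ifs
  all_goals first
    | lia
    | exact splitFlat_mono K _ _ _ _ (fun _ _ h => h) hF
    | exact splitFlat_mono K _ _ _ _ (fun _ _ _ => rfl) hF
    | exact splitFlat_mono K _ _ _ _ h23 hF

-- The core gives `0, …, m - 1`, and each of the `d - 3` kept outer vertices gives a 2; for `d ≤ 3`
-- there are none, so no degree condition is needed.
open Classical in
theorem restrict_splitFlat_freeWithExponents_low (K : Type*) [Field K] {m : ℕ} {κ : Fin 4 → Fin m}
    (hκ : Function.Surjective κ) {d : ℕ} (hd : d ≤ 6 * k + 3) (hm : m = min d 3)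
    (h2 : 3 < d → ∀ t, IsPersistent k t → ((outerNeighbors k t).image κ).card = 2) :
    Module.finrank K (splitFlat K (extendedQFourIso k) κ (lowOuter k d) (outerParent k)) = d ∧
    ((graphicArrangement K (extendedQFour k)).restrict
      (splitFlat K (extendedQFourIso k) κ (lowOuter k d) (outerParent k))).FreeWithExponents
        fun i : Fin d => extendedQFourExponent k i := by
  have hr : Module.finrank K
      (splitFlat K (extendedQFourIso k) κ (lowOuter k d) (outerParent k)) = d := by
    rw [finrank_splitFlat K _ _ _ _ hκ, card_lowOuter k hd]
    lia
  refine ⟨hr, restrict_splitFlat_freeWithExponents k K hκ _ hr fun q => ?_⟩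
  have hdeg : (Finset.univ.filter fun t => lowOuter k d t ∧
      ((outerNeighbors k t).image κ).card = q).card = if q = 2 then d - 3 else 0 := by
    have hlow : ∀ t, lowOuter k d t → ((outerNeighbors k t).image κ).card = 2 :=
      fun t ⟨h, h'⟩ => h2 (by lia) t h
    split_ifs with hq
    · rw [← card_lowOuter k hd]
      congr 1
      ext t
      simp only [Finset.mem_filter, Finset.mem_univ, true_and, hq]
      exact ⟨fun h => h.1, fun h => ⟨h, hlow t h⟩⟩
    · rw [Finset.card_eq_zero, Finset.filter_eq_empty_iff]
      rintro t - ⟨h, h'⟩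
      exact hq (h' ▸ hlow t h)
  rw [hdeg, card_filter_extendedQFourExponent]
  split_ifs <;> lia

-- The intact core and all tips fill dimension `6k + 4` with a single exponent 3; each further
-- dimension releases one `v_i`, adding a 3.
open Classical in
theorem restrict_splitFlat_freeWithExponents_high (K : Type*) [Field K] {d : ℕ}
    (hd : 6 * k + 3 < d) (hd' : d ≤ 7 * k + 4) :
    Module.finrank K (splitFlat K (extendedQFourIso k) (id : Fin 4 → Fin 4) (highOuter k d)
      (outerParent k)) = d ∧
    ((graphicArrangement K (extendedQFour k)).restrict
      (splitFlat K (extendedQFourIso k) (id : Fin 4 → Fin 4) (highOuter k d)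
        (outerParent k))).FreeWithExponents fun i : Fin d => extendedQFourExponent k i := by
  have h1 : (Finset.univ.filter fun i : Fin k => (i : ℕ) + (6 * k + 4) < d).card =
      d - (6 * k + 4) := by
    rw [← Finset.card_map Fin.valEmbedding]
    conv_rhs => rw [← Finset.card_range (d - (6 * k + 4))]
    congr 1
    ext i
    simp only [Finset.mem_map, Finset.mem_filter, Finset.mem_univ, true_and, Finset.mem_range]
    exact ⟨fun ⟨j, hj, e⟩ => by rw [← e]; simp; lia, fun h => ⟨⟨i, by lia⟩, by simp; lia, rfl⟩⟩
  have h6 : Fintype.card (InnerEdge 4) = 6 := by decide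
  have h2 : ∀ e : InnerEdge 4, ({e.1.1, e.1.2} : Finset (Fin 4)).card = 2 := by decide
  have hr : Module.finrank K (splitFlat K (extendedQFourIso k) (id : Fin 4 → Fin 4)
      (highOuter k d) (outerParent k)) = d := by
    rw [finrank_splitFlat K _ _ _ _ Function.surjective_id, card_filter_sum_type,
      card_filter_congr (P := fun u => highOuter k d (Sum.inl u)) (Q := fun _ => True) fun _ => Iff.rfl,
      card_filter_congr (P := fun v => highOuter k d (Sum.inr v))
        (Q := fun v => (v : ℕ) + (6 * k + 4) < d) fun _ => Iff.rfl, h1]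
    simp [h6]
    lia
  refine ⟨hr, restrict_splitFlat_freeWithExponents k K Function.surjective_id _ hr fun q => ?_⟩
  rw [card_filter_extendedQFourExponent, card_filter_sum_type,
    card_filter_congr (Q := fun _ : Σ _ : InnerEdge 4, Fin k => 2 = q) fun u => by
      rw [Finset.image_id, outerNeighbors, h2]
      exact iff_of_eq (true_and _),
    card_filter_congr (Q := fun v : Fin k => (v : ℕ) + (6 * k + 4) < d ∧ 3 = q) fun v => by
      rw [Finset.image_id]
      rfl]
  by_cases hq2 : q = 2
  · subst hq2
    simp [h6]
    lia
  · by_cases hq3 : q = 3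
    · subst hq3
      simp [h1]
      lia
    · simp [Ne.symm hq2, Ne.symm hq3]
      split_ifs <;> lia

theorem isAccuracyWitness_accuracyWitness (K : Type*) [Field K] :
    (graphicArrangement K (extendedQFour k)).IsAccuracyWitness (accuracyWitness k K) := by
  refine ⟨fun i => extendedQFourExponent k i, fun i j h => extendedQFourExponent_monotone k h,
    extendedQFour_freeWithExponents k K, fun d hd1 hd => ?_⟩
  rw [finrank_extendedQFour] at hd
  by_cases h1 : d ≤ 1
  · rw [show accuracyWitness k K d = splitFlat K (extendedQFourIso k) (fun _ => (0 : Fin 1))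
      (lowOuter k d) (outerParent k) from if_pos h1]
    obtain ⟨hr, hf⟩ := restrict_splitFlat_freeWithExponents_low k K
      (κ := fun _ => (0 : Fin 1)) (fun i => ⟨0, Subsingleton.elim _ _⟩) (d := d) (by lia) (by lia)
      fun h => by lia
    exact ⟨isFlat_splitFlat K _ _ _ _ (outerParent_mem k), hr, hf⟩
  by_cases h2 : d ≤ 2
  · rw [show accuracyWitness k K d = splitFlat K (extendedQFourIso k)
      (![0, 0, 1, 0] : Fin 4 → Fin 2) (lowOuter k d) (outerParent k) from
        (if_neg h1).trans (if_pos h2)]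
    obtain ⟨hr, hf⟩ := restrict_splitFlat_freeWithExponents_low k K
      (κ := (![0, 0, 1, 0] : Fin 4 → Fin 2)) (by decide) (d := d) (by lia) (by lia)
      fun h => by lia
    exact ⟨isFlat_splitFlat K _ _ _ _ (outerParent_mem k), hr, hf⟩
  by_cases h3 : d ≤ 6 * k + 3
  · rw [show accuracyWitness k K d = splitFlat K (extendedQFourIso k)
      (![0, 0, 1, 2] : Fin 4 → Fin 3) (lowOuter k d) (outerParent k) from
        (if_neg h1).trans ((if_neg h2).trans (if_pos h3))]
    suffices h : ∀ t, IsPersistent k t →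
        ((outerNeighbors k t).image (![0, 0, 1, 2] : Fin 4 → Fin 3)).card = 2 by
      obtain ⟨hr, hf⟩ := restrict_splitFlat_freeWithExponents_low k K
        (κ := (![0, 0, 1, 2] : Fin 4 → Fin 3)) (by decide) (d := d) (by lia) (by lia) fun _ => h
      exact ⟨isFlat_splitFlat K _ _ _ _ (outerParent_mem k), hr, hf⟩
    -- Only the edge `{0, 1}` is collapsed, and `{0, 1, 2}` has two classes as its image.
    rintro (⟨e, j⟩ | v) h
    · have : ∀ e : InnerEdge 4, e ≠ ⟨(0, 1), by decide⟩ →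
          (({e.1.1, e.1.2} : Finset (Fin 4)).image (![0, 0, 1, 2] : Fin 4 → Fin 3)).card = 2 := by
        decide
      exact this e h
    · rfl
  · rw [show accuracyWitness k K d = splitFlat K (extendedQFourIso k)
      (id : Fin 4 → Fin 4) (highOuter k d) (outerParent k) from
        (if_neg h1).trans ((if_neg h2).trans (if_neg h3))]
    obtain ⟨hr, hf⟩ := restrict_splitFlat_freeWithExponents_high k K (d := d) (by lia) hd
    exact ⟨isFlat_splitFlat K _ _ _ _ (outerParent_mem k), hr, hf⟩

end Witness

/-! ### Dimension bounds, and the extra derivation of a pendant vertex -/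

section Pendant

variable {K : Type*} [Field K] {U : Type*} [Fintype U]

theorem finrank_le_card_of_determined (X : Submodule K (U → K)) (R : Finset U)
    (h : ∀ f ∈ X, (∀ u ∈ R, f u = 0) → f = 0) : Module.finrank K X ≤ R.card := by
  let r : X →ₗ[K] (R → K) := LinearMap.funLeft K K (Subtype.val : R → U) ∘ₗ X.subtype
  have hr : Function.Injective r := by
    refine (injective_iff_map_eq_zero r).2 fun f hf => Subtype.ext (h f f.2 fun u hu => ?_)
    exact congrFun hf ⟨u, hu⟩
  simpa using LinearMap.finrank_le_finrank_of_injective hr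

/-- Coordinates determined by the remaining ones cost one dimension each; this bounds the dimension
of a flat once collapsing vertices are known. -/
theorem finrank_add_card_le_of_determined (X : Submodule K (U → K)) {I : Type*} [Fintype I]
    {g : I → U} (hg : Function.Injective g)
    (h : ∀ f ∈ X, (∀ u, u ∉ Set.range g → f u = 0) → f = 0) :
    Module.finrank K X + Fintype.card I ≤ Fintype.card U := by
  classical
  have h1 := finrank_le_card_of_determined X (Finset.univ.image g)ᶜ fun f hf h0 =>
    h f hf fun u hu => h0 u (by simpa using hu)
  have h2 := Finset.card_le_univ (Finset.univ.image g)
  rw [Finset.card_compl] at h1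
  rw [Finset.card_image_of_injective _ hg, Finset.card_univ] at h1 h2
  lia

variable {V ι : Type*} [AddCommGroup V] [Module K V] [Fintype ι] (b : Module.Basis ι K V)

/-- The derivation sending a linear form `α` to `α x` times `g`. -/
noncomputable def pointDerivation (x : V) (g : MvPolynomial ι K) :
    Derivation K (MvPolynomial ι K) (MvPolynomial ι K) :=
  derivationOfLinear b
    (LinearMap.mulRight K g ∘ₗ Algebra.linearMap K (MvPolynomial ι K) ∘ₗ Module.Dual.eval K V x)

theorem pointDerivation_linearFormPoly (x : V) (g : MvPolynomial ι K) (α : Module.Dual K V) :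
    pointDerivation b x g (linearFormPoly b α) = C (α x) * g := by
  simp [pointDerivation, algebraMap_eq]

theorem isHomogeneous_pointDerivation (x : V) {g : MvPolynomial ι K} {p : ℕ}
    (hg : g.IsHomogeneous p) (j : ι) : (pointDerivation b x g (X j)).IsHomogeneous p := by
  rw [← linearFormPoly_coord b, pointDerivation_linearFormPoly]
  simpa using (isHomogeneous_C ι _).mul hg

/-- Intended for the constant derivation, the Euler derivation and the one of a pendant vertex `w`
attached to `x`. Comparing the values at `x` and `z` kills the Euler coefficient, and the rest
follows. -/
theorem linearIndependent_of_triangular_values {σ : Type*}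
    {D : Submodule (MvPolynomial σ K) (Derivation K (MvPolynomial σ K) (MvPolynomial σ K))}
    (η : Fin 3 → D) {x z w : MvPolynomial σ K} (hz : z - x ≠ 0) (hw : w - x ≠ 0)
    (h0 : (η 0).1 x = 1 ∧ (η 0).1 z = 1 ∧ (η 0).1 w = 1)
    (h1 : (η 1).1 x = x ∧ (η 1).1 z = z ∧ (η 1).1 w = w)
    (h2 : (η 2).1 x = 0 ∧ (η 2).1 z = 0 ∧ (η 2).1 w = w - x) :
    LinearIndependent (MvPolynomial σ K) η := by
  refine LinearIndependent.of_comp D.subtype ?_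
  rw [Fintype.linearIndependent_iff]
  intro c hc
  have key : ∀ u, c 0 * (η 0).1 u + c 1 * (η 1).1 u + c 2 * (η 2).1 u = 0 := fun u => by
    have h3 := congrArg (derivationEval u) ((Fin.sum_univ_three _).symm.trans hc)
    simp only [map_add, map_smul, map_zero, smul_eq_mul] at h3
    exact h3
  have k1 := key x
  have k2 := key z
  have k3 := key w
  rw [h0.1, h1.1, h2.1] at k1
  rw [h0.2.1, h1.2.1, h2.2.1] at k2
  rw [h0.2.2, h1.2.2, h2.2.2] at k3
  have e1 : c 1 = 0 :=
    (mul_eq_zero.1 (show c 1 * (z - x) = 0 by linear_combination k2 - k1)).resolve_right hz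
  have e0 : c 0 = 0 := by simpa [e1] using k1
  have e2 : c 2 = 0 := by
    rw [e0, e1, zero_mul, zero_mul, zero_add, zero_add] at k3
    exact (mul_eq_zero.1 k3).resolve_right hw
  intro j
  fin_cases j
  · exact e0
  · exact e1
  · exact e2

/-- If the vertex `t` becomes pendant in a contraction of a connected graph with at least three
vertices, then there are at least three exponents at most `1`. -/
theorem three_le_card_of_pendant {G : SimpleGraph U} {X : Submodule K (U → K)} {t i : U}
    (hti : t ≠ i) (hone : (fun _ => 1) ∈ X) [DecidableEq U] (ht : Pi.single t 1 ∈ X)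
    (hadj : ∀ u, G.Adj t u → ∀ f ∈ X, f u = f i) (hX : 3 ≤ Module.finrank K X) {d : ℕ}
    {e : Fin d → ℕ} (he : ((graphicArrangement K G).restrict X).FreeWithExponents e) :
    3 ≤ (Finset.univ.filter fun j => e j ≤ 1).card := by
  obtain ⟨b, θ, hθ⟩ := he
  let ev : U → Module.Dual K X := fun u => (LinearMap.proj u : (U → K) →ₗ[K] K) ∘ₗ X.subtype
  have hev : ∀ u (f : X), ev u f = (f : U → K) u := fun _ _ => rfl
  -- Otherwise all coordinates on `X` are determined by those at `t` and `i`, and the dimension is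
  -- at most 2.
  obtain ⟨s, hst, hsi⟩ : ∃ s, s ≠ t ∧ ev s ≠ ev i := by
    by_contra! h
    have := finrank_le_card_of_determined X {t, i} fun f hf h0 => by
      ext u
      by_cases hu : u = t
      · exact hu ▸ h0 t (by simp)
      · have := LinearMap.congr_fun (h u hu) ⟨f, hf⟩
        rw [hev, hev] at this
        exact this.trans (h0 i (by simp))
    have := this.trans Finset.card_le_two
    lia
  let Y : U → MvPolynomial (Fin d) K := fun u => linearFormPoly b (ev u)
  have hY : ∀ u w, ev u ≠ ev w → Y u - Y w ≠ 0 := fun u w h h0 =>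
    h (linearFormPolyHom_injective b (sub_eq_zero.1 h0))
  have hti' : ev t ≠ ev i := fun h => by
    have := LinearMap.congr_fun h ⟨_, ht⟩
    simp [hev, hti.symm] at this
  let I := {q : U × U // G.Adj q.1 q.2 ∧ ¬ X ≤ LinearMap.ker
    ((LinearMap.proj q.1 : (U → K) →ₗ[K] K) - (LinearMap.proj q.2 : (U → K) →ₗ[K] K))}
  have hmem := fun θ => ((graphicArrangement K G).restrict X).mem_derivationModule_iff b
    (I := I) (α := fun q => ev q.1.1 - ev q.1.2) (θ := θ) (by
      ext H
      constructor
      · rintro ⟨_, ⟨⟨u, w, huw, rfl⟩, hX⟩, rfl⟩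
        exact ⟨⟨(u, w), huw, hX⟩, rfl⟩
      · rintro ⟨⟨⟨u, w⟩, huw, hX⟩, rfl⟩
        exact ⟨_, ⟨⟨u, w, huw, rfl⟩, hX⟩, rfl⟩) (by
      rintro ⟨⟨u, w⟩, huw, hX⟩ h0
      refine hX fun f hf => ?_
      exact LinearMap.congr_fun h0 ⟨f, hf⟩)
  let oneX : X := ⟨_, hone⟩
  let tX : X := ⟨_, ht⟩
  have h0 : pointDerivation b oneX 1 ∈ ((graphicArrangement K G).restrict X).derivationModule b :=
    (hmem _).2 fun q => by
      rw [pointDerivation_linearFormPoly]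
      simp [hev, oneX]
  have h1 : derivationOfLinear b (linearFormPolyHom b) ∈
      ((graphicArrangement K G).restrict X).derivationModule b :=
    (hmem _).2 fun q => by simp
  -- This is `(y_t - y_i) ∂_t`: all edges at `t` restrict to the form `y_t - y_i` up to sign, and
  -- every other edge form is killed.
  have h2 : pointDerivation b tX (Y t - Y i) ∈
      ((graphicArrangement K G).restrict X).derivationModule b :=
    (hmem _).2 fun ⟨⟨u, w⟩, huw, hX⟩ => by
      have hadj' : ∀ u, G.Adj t u → Y u = Y i := fun u hu => by
        have : ev u = ev i := LinearMap.ext fun f => hadj u hu f f.2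
        simp only [Y, this]
      rw [pointDerivation_linearFormPoly, linearFormPoly_sub]
      by_cases hu : u = t
      · subst hu
        rw [show linearFormPoly b (ev w) = Y i from hadj' w huw]
        exact Dvd.intro_left _ rfl
      by_cases hw : w = t
      · subst hw
        rw [show linearFormPoly b (ev u) = Y i from hadj' u huw.symm, ← neg_sub, neg_dvd]
        exact Dvd.intro_left _ rfl
      · simp [hev, tX, hu, hw]
  let η : Fin 3 → ((graphicArrangement K G).restrict X).derivationModule b :=
    ![⟨_, h0⟩, ⟨_, h1⟩, ⟨_, h2⟩]
  have hη : LinearIndependent (MvPolynomial (Fin d) K) η := by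
    have hv : ∀ u, pointDerivation b tX (Y t - Y i) (Y u) = C (ev u tX) * (Y t - Y i) :=
      fun u => pointDerivation_linearFormPoly b _ _ _
    have h1v : ∀ u, pointDerivation b oneX 1 (Y u) = 1 := fun u => by
      simp [Y, pointDerivation_linearFormPoly, hev, oneX]
    refine linearIndependent_of_triangular_values η (x := Y i) (z := Y s) (w := Y t)
      (hY s i hsi) (hY t i hti') ⟨h1v _, h1v _, h1v _⟩ ⟨?_, ?_, ?_⟩ ⟨?_, ?_, ?_⟩
    · exact derivationOfLinear_linearFormPoly b _ _
    · exact derivationOfLinear_linearFormPoly b _ _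
    · exact derivationOfLinear_linearFormPoly b _ _
    · exact (hv i).trans (by simp [hev, tX, hti.symm])
    · exact (hv s).trans (by simp [hev, tX, hst])
    · exact (hv t).trans (by simp [hev, tX])
  have hhom : ∀ m j, ((η m : Derivation K (MvPolynomial (Fin d) K) (MvPolynomial (Fin d) K))
      (MvPolynomial.X j)).IsHomogeneous ((![0, 1, 1] : Fin 3 → ℕ) m) := by
    intro m j
    fin_cases m
    · exact isHomogeneous_pointDerivation b oneX (isHomogeneous_one _ _) j
    · change (derivationOfLinear b (linearFormPolyHom b) (MvPolynomial.X j)).IsHomogeneous 1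
      rw [← linearFormPoly_coord b, derivationOfLinear_linearFormPoly]
      exact isHomogeneous_linearFormPoly b _
    · exact isHomogeneous_pointDerivation b tX
        ((isHomogeneous_linearFormPoly b _).sub (isHomogeneous_linearFormPoly b _)) j
  simpa using card_le_card_degree_le θ hθ hη (f := ![0, 1, 1]) (p := 1) (by decide) hhom

end Pendant

/-! ### The shape of arbitrary flats of split graphs -/

section FlatsOfSplitGraphs

variable {K : Type*} [Field K] {U : Type*} [Finite U] {n : ℕ} {T : Type*}
  {N : T → Finset (Fin n)} {G : SimpleGraph U} (φ : splitGraph N ≃g G) {X : Submodule K (U → K)}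

theorem one_mem_of_isFlat (hX : (graphicArrangement K G).IsFlat X) : (fun _ => 1) ∈ X := by
  obtain ⟨B, hB, rfl⟩ := hX
  refine Submodule.mem_sInf.2 fun H hH => ?_
  obtain ⟨i, j, -, rfl⟩ := hB hH
  simp

/-- Some hyperplane cutting out the flat excludes the indicator of `t`, so its edge ends at `t`; the
other end is in the core because outer vertices are not adjacent. -/
theorem exists_eq_of_single_not_mem [DecidableEq U] (hX : (graphicArrangement K G).IsFlat X) {t : T}
    (ht : Pi.single (φ (Sum.inr t)) 1 ∉ X) :
    ∃ j ∈ N t, ∀ f ∈ X, f (φ (Sum.inr t)) = f (φ (Sum.inl j)) := by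
  obtain ⟨B, hB, rfl⟩ := hX
  rw [Submodule.mem_sInf] at ht
  push Not at ht
  obtain ⟨H, hH, htH⟩ := ht
  obtain ⟨u, w, huw, rfl⟩ := hB hH
  have hf : ∀ f ∈ sInf B, f u = f w := fun f hf => by
    simpa [sub_eq_zero] using (Submodule.mem_sInf.1 hf) _ hH
  have key : ∀ w, G.Adj (φ (Sum.inr t)) w → (∀ f ∈ sInf B, f (φ (Sum.inr t)) = f w) →
      ∃ j ∈ N t, ∀ f ∈ sInf B, f (φ (Sum.inr t)) = f (φ (Sum.inl j)) := by
    intro w hw h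
    obtain ⟨z, rfl⟩ := φ.surjective w
    have hz := φ.map_adj_iff.1 hw
    rcases z with j | t'
    · exact ⟨j, hz, h⟩
    · exact hz.elim
  by_cases hu : u = φ (Sum.inr t)
  · subst hu
    exact key w huw hf
  by_cases hw : w = φ (Sum.inr t)
  · subst hw
    exact key u huw.symm fun f h => (hf f h).symm
  · exact (htH (by simp [hu, hw])).elim

/-- A flat on which no two inner vertices are identified. -/
theorem eq_splitFlat_of_isFlat [DecidableEq U] (hX : (graphicArrangement K G).IsFlat X) (p : T → Fin n)
    (hp : ∀ t, Pi.single (φ (Sum.inr t)) 1 ∉ X →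
      ∀ f ∈ X, f (φ (Sum.inr t)) = f (φ (Sum.inl (p t))))
    (hcore : ∀ i j, (∀ f ∈ X, f (φ (Sum.inl i)) = f (φ (Sum.inl j))) → i = j) :
    X = splitFlat K φ id (fun t => Pi.single (φ (Sum.inr t)) 1 ∈ X) p := by
  refine le_antisymm (fun f hf => ⟨fun i j h => by rw [show i = j from h],
    fun t ht => hp t ht f hf⟩) fun f hf => ?_
  obtain ⟨B, hB, hXB⟩ := hX
  rw [hXB, Submodule.mem_sInf]
  intro H hH
  obtain ⟨u, w, huw, rfl⟩ := hB hH
  have hg : ∀ g ∈ X, g u = g w := fun g hg => by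
    rw [hXB] at hg
    simpa [sub_eq_zero] using (Submodule.mem_sInf.1 hg) _ hH
  rw [LinearMap.mem_ker, LinearMap.sub_apply, sub_eq_zero]
  change f u = f w
  -- A core vertex glued to `t` is glued to `p t` as well, hence equals it.
  have side : ∀ i t, (∀ g ∈ X, g (φ (Sum.inl i)) = g (φ (Sum.inr t))) →
      f (φ (Sum.inl i)) = f (φ (Sum.inr t)) := by
    intro i t h
    have ht : Pi.single (φ (Sum.inr t)) 1 ∉ X := fun ht => by
      have := h _ ht
      simp at this
    rw [hf.2 t ht, hcore i (p t) fun g hg => (h g hg).trans (hp t ht g hg)]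
  obtain ⟨x, rfl⟩ := φ.surjective u
  obtain ⟨z, rfl⟩ := φ.surjective w
  rcases x with i | t <;> rcases z with j | t'
  · rw [hcore i j hg]
  · exact side i t' hg
  · exact (side j t fun g h => (hg g h).symm).symm
  · exact (φ.map_adj_iff.1 huw).elim

end FlatsOfSplitGraphs

/-! ### No witness has a flag reaching dimension `6k + 4` -/

section NoLongFlag

variable {K : Type*} [Field K] {k : ℕ}

/-- The multiset of exponents is determined by `D(A)`, and a multiset has only one monotone
enumeration. -/
theorem eq_extendedQFourExponent
    {e : Fin (Module.finrank K (QVertex 4 (fun _ => k) ⊕ Fin k → K)) → ℕ} (hmono : Monotone e)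
    (he : (graphicArrangement K (extendedQFour k)).FreeWithExponents e) :
    e = fun i : Fin (Module.finrank K (QVertex 4 (fun _ => k) ⊕ Fin k → K)) =>
      extendedQFourExponent k i := by
  set E := fun i : Fin (Module.finrank K (QVertex 4 (fun _ => k) ⊕ Fin k → K)) =>
    extendedQFourExponent k i with hE
  have h1 := (freeWithExponents_graphicArrangement_iff K (extendedQFourIso k) rfl e).1 he
  have h2 := (freeWithExponents_graphicArrangement_iff K (extendedQFourIso k) rfl E).1
    (extendedQFour_freeWithExponents k K)
  have hcard : ∀ q, Nonempty ({i // e i = q} ≃ {i // E i = q}) := fun q => by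
    rw [← Fintype.card_eq, Fintype.card_subtype, Fintype.card_subtype, h1 q, h2 q]
  let σ := Equiv.ofFiberEquiv (f := e) (g := E) fun q => (hcard q).some
  have hσ : E ∘ σ = e := funext fun i => Equiv.ofFiberEquiv_map _ i
  have := Tuple.unique_monotone (f := E) (σ := σ) (τ := 1) (by rwa [hσ])
    fun i j h => extendedQFourExponent_monotone k h
  rw [hσ] at this
  exact this

variable {X : Submodule K (QVertex 4 (fun _ => k) ⊕ Fin k → K)} {d : ℕ}

/-- If two inner vertices are identified in a flat with the expected exponents, then so are all
common outer neighbours. -/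
theorem tip_eq_of_core_eq [DecidableEq (QVertex 4 (fun _ => k) ⊕ Fin k)]
    (hX : (graphicArrangement K (extendedQFour k)).IsFlat X) (hd : Module.finrank K X = d)
    (hd3 : 3 ≤ d)
    (he : ((graphicArrangement K (extendedQFour k)).restrict X).FreeWithExponents
      fun i : Fin d => extendedQFourExponent k i)
    (e : InnerEdge 4) (hij : ∀ f ∈ X, f (extendedQFourIso k (Sum.inl e.1.1)) =
      f (extendedQFourIso k (Sum.inl e.1.2))) (a : Fin k) :
    ∀ f ∈ X, f (extendedQFourIso k (Sum.inr (Sum.inl ⟨e, a⟩))) =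
      f (extendedQFourIso k (Sum.inl e.1.2)) := by
  have hN : ∀ j ∈ outerNeighbors k (Sum.inl ⟨e, a⟩), ∀ f ∈ X,
      f (extendedQFourIso k (Sum.inl j)) = f (extendedQFourIso k (Sum.inl e.1.2)) := by
    intro j hj f hf
    rcases Finset.mem_insert.1 hj with rfl | hj
    · exact hij f hf
    · rw [Finset.mem_singleton.1 hj]
  by_cases ht : Pi.single (extendedQFourIso k (Sum.inr (Sum.inl ⟨e, a⟩))) 1 ∈ X
  · exfalso
    -- A free tip would be pendant, giving three exponents at most 1, whereas only `0` and `1` are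
    -- available.
    have h3 := three_le_card_of_pendant (G := extendedQFour k)
      (i := extendedQFourIso k (Sum.inl e.1.2)) (by simp) (one_mem_of_isFlat hX) ht (by
        intro u hu f hf
        obtain ⟨x, rfl⟩ := (extendedQFourIso k).surjective u
        have hx := (extendedQFourIso k).map_adj_iff.1 hu
        rcases x with j | t
        · exact hN j hx f hf
        · exact hx.elim) (hd3.trans_eq hd.symm) he
    have h0 := card_filter_extendedQFourExponent k d 0
    have h1 := card_filter_extendedQFourExponent k d 1
    have : (Finset.univ.filter fun i : Fin d => extendedQFourExponent k i ≤ 1) =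
        (Finset.univ.filter fun i : Fin d => extendedQFourExponent k i = 0) ∪
          Finset.univ.filter fun i : Fin d => extendedQFourExponent k i = 1 := by
      ext i
      simp only [Finset.mem_filter, Finset.mem_univ, true_and, Finset.mem_union]
      lia
    rw [this] at h3
    have := h3.trans (Finset.card_union_le _ _)
    rw [h0, h1] at this
    simp at this
    lia
  · obtain ⟨j, hj, h⟩ := exists_eq_of_single_not_mem (extendedQFourIso k) hX ht
    exact fun f hf => (h f hf).trans (hN j hj f hf)

/-- If no two inner vertices are identified in a flat, then there is an exponent `3`, and a further
one for every outer vertex of degree `3` which is not identified with any other vertex. -/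
theorem card_exponent_three [DecidableEq (QVertex 4 (fun _ => k) ⊕ Fin k)]
    (hX : (graphicArrangement K (extendedQFour k)).IsFlat X) (hd : Module.finrank K X = d)
    (he : ((graphicArrangement K (extendedQFour k)).restrict X).FreeWithExponents
      fun i : Fin d => extendedQFourExponent k i)
    (hcore : ∀ i j, (∀ f ∈ X, f (extendedQFourIso k (Sum.inl i)) =
      f (extendedQFourIso k (Sum.inl j))) → i = j) :
    6 * k + 4 ≤ d ∧ (d = 6 * k + 4 → ∀ v, ∃ j, ∀ f ∈ X,
      f (extendedQFourIso k (Sum.inr (Sum.inr v))) = f (extendedQFourIso k (Sum.inl j))) := by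
  classical
  have hp : ∀ t, ∃ j ∈ outerNeighbors k t,
      Pi.single (extendedQFourIso k (Sum.inr t)) 1 ∉ X → ∀ f ∈ X,
        f (extendedQFourIso k (Sum.inr t)) = f (extendedQFourIso k (Sum.inl j)) := by
    intro t
    by_cases ht : Pi.single (extendedQFourIso k (Sum.inr t)) 1 ∈ X
    · exact ⟨_, outerParent_mem k t, fun h => (h ht).elim⟩
    · obtain ⟨j, hj, h⟩ := exists_eq_of_single_not_mem (extendedQFourIso k) hX ht
      exact ⟨j, hj, fun _ => h⟩
  choose p _ hp using hp
  have hXe := eq_splitFlat_of_isFlat (extendedQFourIso k) hX p hp hcore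
  -- The predicate mentions `X`, so it is made opaque before `X` is rewritten.
  generalize hF : (fun t => Pi.single (extendedQFourIso k (Sum.inr t)) 1 ∈ X) = F at hXe
  have hFt : ∀ t, F t ↔ Pi.single (extendedQFourIso k (Sum.inr t)) 1 ∈ X := fun t => by rw [← hF]
  have h3 : (Finset.univ.filter fun i : Fin d => extendedQFourExponent k i = 3).card =
      1 + (Finset.univ.filter fun t : {t // F t} => ((outerNeighbors k t).image id).card = 3).card := by
    have hd' := hd
    rw [hXe] at he hd'
    have := (freeWithExponents_restrict_splitFlat_iff K (extendedQFourIso k) id F p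
      Function.surjective_id hd' _).1 he 3
    rw [this, card_filter_splitDegree, if_pos (by lia)]
  rw [card_filter_extendedQFourExponent] at h3
  simp only [OfNat.ofNat_ne_zero, OfNat.ofNat_ne_one, Nat.reduceEqDiff, if_false, if_true] at h3
  -- `h3` says that `d - (6k + 3)` is 1, from the intact core, plus the number of free `v_i`; at `d
  -- = 6k + 4` none is free.
  refine ⟨by lia, fun hdk v => ?_⟩
  have h0 : (Finset.univ.filter fun t : {t // F t} =>
      ((outerNeighbors k t).image id).card = 3).card = 0 := by lia
  have hv : ¬ F (Sum.inr v) := fun hv =>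
    Finset.filter_eq_empty_iff.1 (Finset.card_eq_zero.1 h0)
      (Finset.mem_univ (⟨Sum.inr v, hv⟩ : {t // F t})) rfl
  rw [hFt] at hv
  exact ⟨_, hp _ hv⟩

theorem not_le_of_isAccuracyWitness (hk : 1 ≤ k)
    {X : ℕ → Submodule K (QVertex 4 (fun _ => k) ⊕ Fin k → K)}
    (hX : (graphicArrangement K (extendedQFour k)).IsAccuracyWitness X) :
    ¬ X (6 * k + 3) ≤ X (6 * k + 4) := by
  classical
  intro hle
  obtain ⟨e, hmono, he, hw⟩ := hX
  obtain rfl := eq_extendedQFourExponent hmono he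
  have hfin := finrank_extendedQFour k K
  obtain ⟨hf1, hd1, he1⟩ := hw (6 * k + 3) (by lia) (hfin ▸ by lia)
  obtain ⟨hf2, hd2, he2⟩ := hw (6 * k + 4) (by lia) (hfin ▸ by lia)
  have hcardU : Fintype.card (QVertex 4 (fun _ => k) ⊕ Fin k) = 7 * k + 4 := by
    rwa [Module.finrank_fintype_fun_eq_card] at hfin
  have hedge : ∀ {Z : Submodule K (QVertex 4 (fun _ => k) ⊕ Fin k → K)},
      (¬ ∀ i j, (∀ f ∈ Z, f (extendedQFourIso k (Sum.inl i)) =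
        f (extendedQFourIso k (Sum.inl j))) → i = j) →
      ∃ e : InnerEdge 4, ∀ f ∈ Z, f (extendedQFourIso k (Sum.inl e.1.1)) =
        f (extendedQFourIso k (Sum.inl e.1.2)) := by
    intro Z h
    push Not at h
    obtain ⟨i, j, h, hij⟩ := h
    rcases lt_or_gt_of_ne hij with hij | hij
    · exact ⟨⟨(i, j), hij⟩, h⟩
    · exact ⟨⟨(j, i), hij⟩, fun f hf => (h f hf).symm⟩
  -- A collapsed core edge takes its `k` tips along, leaving dimension at most `7k + 4 - (k + 1) =
  -- 6k + 3`.
  have hcore2 : ∀ i j, (∀ f ∈ X (6 * k + 4), f (extendedQFourIso k (Sum.inl i)) =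
      f (extendedQFourIso k (Sum.inl j))) → i = j := by
    by_contra h
    obtain ⟨e, hij⟩ := hedge h
    have htip := tip_eq_of_core_eq hf2 hd2 (by lia) he2 e hij
    have := finrank_add_card_le_of_determined (X (6 * k + 4)) (I := Unit ⊕ Fin k)
      (g := extendedQFourIso k ∘ Sum.elim (fun _ => Sum.inl e.1.2)
        fun a => Sum.inr (Sum.inl ⟨e, a⟩))
      ((extendedQFourIso k).injective.comp (by
        rintro (_ | a) (_ | c) h <;> simp at h ⊢
        exact h)) (by
      intro f hf h0
      have hj : f (extendedQFourIso k (Sum.inl e.1.2)) = 0 := by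
        rw [← hij f hf]
        refine h0 _ ?_
        rintro ⟨_ | a, h⟩
        · have := (extendedQFourIso k).injective h
          simp [e.2.ne'] at this
        · have := (extendedQFourIso k).injective h
          simp at this
      ext u
      by_cases hu : u ∈ Set.range (extendedQFourIso k ∘ Sum.elim
          (fun _ : Unit => Sum.inl e.1.2) fun a => Sum.inr (Sum.inl ⟨e, a⟩))
      · obtain ⟨_ | a, rfl⟩ := hu
        · exact hj
        · exact (htip a f hf).trans hj
      · exact h0 u hu)
    rw [hd2, hcardU] at this
    simp at this
    lia
  have hv := (card_exponent_three hf2 hd2 he2 hcore2).2 rfl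
  obtain ⟨e, hij⟩ := hedge fun h => by
    have := (card_exponent_three hf1 hd1 he1 h).1
    lia
  have htip := tip_eq_of_core_eq hf1 hd1 (by lia) he1 e hij
  -- One core vertex, `k` tips and all `k` of the `v_i` are lost: the dimension would be at most `5k
  -- + 3`.
  have := finrank_add_card_le_of_determined (X (6 * k + 3)) (I := Unit ⊕ Fin k ⊕ Fin k)
    (g := extendedQFourIso k ∘ Sum.elim (fun _ => Sum.inl e.1.2)
      (Sum.elim (fun a => Sum.inr (Sum.inl ⟨e, a⟩)) fun v => Sum.inr (Sum.inr v)))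
    ((extendedQFourIso k).injective.comp (by
      rintro (_ | a | v) (_ | c | v') h <;> simp at h ⊢ <;> exact h)) (by
    intro f hf h0
    have hcore : ∀ i, f (extendedQFourIso k (Sum.inl i)) = 0 := by
      have hne : ∀ i, i ≠ e.1.2 → f (extendedQFourIso k (Sum.inl i)) = 0 := by
        intro i hi
        refine h0 _ ?_
        rintro ⟨_ | a | v, h⟩
        · have := (extendedQFourIso k).injective h
          simp [hi.symm] at this
        · have := (extendedQFourIso k).injective h
          simp at this
        · have := (extendedQFourIso k).injective h
          simp at this
      intro i
      by_cases hi : i = e.1.2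
      · rw [hi, ← hij f hf]
        exact hne _ e.2.ne
      · exact hne i hi
    ext u
    by_cases hu : u ∈ Set.range (extendedQFourIso k ∘ Sum.elim
        (fun _ : Unit => Sum.inl e.1.2)
          (Sum.elim (fun a => Sum.inr (Sum.inl ⟨e, a⟩)) fun v => Sum.inr (Sum.inr v)))
    · obtain ⟨_ | a | v, rfl⟩ := hu
      · exact hcore _
      · exact (htip a f hf).trans (hcore _)
      -- The gluing of `v_i` is known only on the larger flat; the assumed inclusion transfers it.
      · obtain ⟨j, hj⟩ := hv v
        exact (hj f (hle hf)).trans (hcore j)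
    · exact h0 u hu)
  rw [hd1, hcardU] at this
  simp at this
  lia

end NoLongFlag

theorem mainTheorem10 (K : Type*) [Field K] (k : ℕ) (hk : 1 ≤ k) :
    (graphicArrangement K (extendedQFour k)).IsCoaccurate (k + 1) ∧
      (∀ j : ℕ, 1 ≤ j → j ≤ k → ¬ (graphicArrangement K (extendedQFour k)).IsCoaccurate j) ∧
      (graphicArrangement K (extendedQFour k)).IsAccurate ∧
      ¬ (graphicArrangement K (extendedQFour k)).IsFlagAccurate := by
  have hfin := finrank_extendedQFour k K
  have hw := isAccuracyWitness_accuracyWitness k K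
  have hno : ∀ X, (graphicArrangement K (extendedQFour k)).IsAccuracyWitness X →
      ∀ n, 6 * k + 4 ≤ n → ¬ CentralArrangement.IsFlagUpTo X n := fun X hX n hn h =>
    not_le_of_isAccuracyWitness hk hX (h _ _ (by lia) (by lia) hn)
  refine ⟨⟨_, hw, ⟨by lia, hfin ▸ by lia, ?_⟩, ?_⟩, ?_, ⟨_, hw⟩, ?_⟩
  · rw [hfin, show 7 * k + 4 - (k + 1) = 6 * k + 3 by lia]
    exact isFlagUpTo_accuracyWitness k K
  · rintro j ⟨-, -, h⟩
    rw [hfin] at h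
    by_contra hj
    exact hno _ hw _ (by lia) h
  -- For `j ≤ k` the flag would reach at least dimension `6k + 4`.
  · rintro j - hj ⟨X, hX, ⟨-, -, h⟩, -⟩
    rw [hfin] at h
    exact hno X hX _ (by lia) h
  · rintro ⟨X, hX, h⟩
    rw [hfin] at h
    exact hno X hX _ (by lia) h
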